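/- \textbf{Definitions.} All alphabets are finite. A \emph{labeled automaton} has a finite set of states $Q$, initial states $Q_0\subseteq Q$, accepting states $F\subseteq Q$, a transition relation $\delta\subseteq Q\times\Sigma\times Q$ and a labeling $C$ of the transitions; it may be non-deterministic. A run on a finite word is accepting if it ends in $F$; a run on an infinite word is accepting if some state of $F$ occurs infinitely often. A \emph{non-deterministic $(\mathrm{LimSup};\mathrm{Sum})$-automaton} (a nested weighted automaton) over $\Sigma$ consists of a master automaton whose transitions are labeled by indices $1,\dots,m$, and slave automata $B_1,\dots,B_m$ over $\Sigma$ whose transitions are labeled by integer weights. A \emph{run} on an infinite word $w=w_0w_1\cdots$ consists of a run $\Pi$ of the master on $w$ and, for every position $i$, a number $\ell_i\ge 0$ and a run $\pi_i$, on the finite word $w_i\cdots w_{i+\ell_i-1}$, of the slave whose index labels the $i$-th transition of $\Pi$. It is \emph{accepting} if $\Pi$ and all $\pi_i$ are accepting and $\ell_i>0$ for infinitely many $i$. Its \emph{value} is the limit superior, in $[-\infty,\infty]$, of the sequence, over the positions $i$ with $\ell_i>0$, of the sums of the weights of the transitions of $\pi_i$. The value $\mathbb A(w)$ is the infimum of the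 values of all accepting runs on $w$ ($+\infty$ if there is none). The automaton has \emph{width $1$} if in every run, for every position $p$, there is at most one $i$ with $i\le p<i+\ell_i$. A \emph{labeled Markov chain} $\mathcal M$ over $\Sigma$ has a finite set of states $S$, an initial state, and rational edge probabilities $E(s,a,s')\ge 0$ with $\sum_{a,s'}E(s,a,s')=1$ for every $s$; $\mathbb P_{\mathcal M}$ is the resulting law of the infinite word of letters on the traversed edges. For an automaton $\mathbb A$ put $\mathbb D_{\mathcal M,\mathbb A}(\lambda)=\mathbb P_{\mathcal M}(\{w:\mathbb A(w)\le\lambda\})$, and let $\mathbb E_{\mathcal M}(\mathbb A)$ be the expectation of $\mathbb A(w)$ under $\mathbb P_{\mathcal M}$. A problem with a set of valid inputs is \emph{undecidable} (for problems that ask for a value: uncomputable) if there is no algorithm, i.e.\ no partial computable function, that halts with a correct output on every valid input. \textbf{Theorem.} (a) The following problem is undecidable: given a non-deterministic $(\mathrm{LimSup};\mathrm{Sum})$-automaton $\mathbb A$ of width $1$ over $\{0,1\}$ such that, under the uniform distribution on infinite words over $\{0,1\}$, almost all words have value $0$ or almost all words have value $-1$, decide which of the two is the case. (b) Consider as inputs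 a non-deterministic $(\mathrm{LimSup};\mathrm{Sum})$-automaton $\mathbb A$ of width $1$ and a labeled Markov chain $\mathcal M$ over the same alphabet such that $\mathbb P_{\mathcal M}$-almost every word has an accepting run. Each of the following problems is undecidable, even if $\Sigma=\{0,1\}$ and $\mathcal M$ is fixed to be the one-state chain that generates the uniform distribution: (Q1) compute $\mathbb E_{\mathcal M}(\mathbb A)$ exactly, even if this is only required on inputs for which it exists and is a rational number; (Q2) given also $\lambda\in\mathbb Q$, compute $\mathbb D_{\mathcal M,\mathbb A}(\lambda)$ exactly, even if this is only required on inputs for which it is a rational number; (Q3) given also a rational $\epsilon>0$, compute a rational $\eta$ with $|\eta-\mathbb E_{\mathcal M}(\mathbb A)|\le\epsilon$, even if this is only required on inputs for which $\mathbb A$ is almost surely finite and integrable; (Q4) given also $\lambda\in\mathbb Q$ and a rational $\epsilon>0$, compute a rational $\eta$ with $|\eta-\mathbb D_{\mathcal M,\mathbb A}(\lambda)|\le\epsilon$; (Q5) given also $\lambda\in\mathbb Q$, decide whether $\mathbb D_{\mathcal M,\mathbb A}(\lambda)=1$. -/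

import Mathlib

open MeasureTheory ProbabilityTheory Filter

noncomputable section

namespace NWAProb

/-! ### Labeled automata and their runs -/

/-- A non-deterministic `X`-labeled automaton over the alphabet `Fin k`, with states
`Fin numStates`. The transition relation and its labeling are given together as a partial function:
`(q, a, q')` is a transition exactly if `delta q a q'` is `some x`, and then `x` is its label. -/
structure LabeledAutomaton (k : ℕ) (X : Type) where
  numStates : ℕ
  init : Finset (Fin numStates)
  accept : Finset (Fin numStates)
  delta : Fin numStates → Fin k → Fin numStates → Option X

namespace LabeledAutomaton

variable {k : ℕ} {X : Type}

/-- A run on the finite word `u` of length `n`: a sequence of `n + 1` states. -/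
structure FinRun (A : LabeledAutomaton k X) {n : ℕ} (u : Fin n → Fin k) where
  state : Fin (n + 1) → Fin A.numStates
  state_zero : state 0 ∈ A.init
  step : ∀ i : Fin n, (A.delta (state i.castSucc) (u i) (state i.succ)).isSome

/-- A finite run is accepting if its last state is accepting. -/
def FinRun.Accepting {A : LabeledAutomaton k X} {n : ℕ} {u : Fin n → Fin k}
    (r : A.FinRun u) : Prop :=
  r.state (Fin.last n) ∈ A.accept

/-- The sequence of labels of the transitions of a finite run. -/
def FinRun.labels {A : LabeledAutomaton k X} {n : ℕ} {u : Fin n → Fin k}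
    (r : A.FinRun u) : List X :=
  List.ofFn fun i : Fin n => (A.delta (r.state i.castSucc) (u i) (r.state i.succ)).get (r.step i)

/-- The value of a finite run of a `g`-automaton: `none` (the empty value `⊥`) if the word is
empty, and `g` of the sequence of weights otherwise. -/
def FinRun.value {A : LabeledAutomaton k ℤ} {n : ℕ} {u : Fin n → Fin k}
    (g : List ℤ → ℤ) (r : A.FinRun u) : Option ℤ :=
  if n = 0 then none else some (g r.labels)

/-- A run on the infinite word `w`. -/
structure InfRun (A : LabeledAutomaton k X) (w : ℕ → Fin k) where
  state : ℕ → Fin A.numStates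
  state_zero : state 0 ∈ A.init
  step : ∀ i, (A.delta (state i) (w i) (state (i + 1))).isSome

/-- An infinite run is accepting if some accepting state occurs infinitely often (Büchi). -/
def InfRun.Accepting {A : LabeledAutomaton k X} {w : ℕ → Fin k} (r : A.InfRun w) : Prop :=
  ∃ q ∈ A.accept, ∃ᶠ i in atTop, r.state i = q

/-- The label of the transition of an infinite run that reads the letter at position `i`. -/
def InfRun.label {A : LabeledAutomaton k X} {w : ℕ → Fin k} (r : A.InfRun w) (i : ℕ) : X :=
  (A.delta (r.state i) (w i) (r.state (i + 1))).get (r.step i)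

end LabeledAutomaton

/-! ### Value functions -/

/-- `LimSup` of a sequence of integers, as an extended real number. -/
def limSupValue (x : ℕ → ℤ) : EReal := limsup (fun n => ((x n : ℝ) : EReal)) atTop

/-- `Sum` of a finite sequence of integers. -/
def sumValue (l : List ℤ) : ℤ := l.sum

/-- The sequence that remains when the silent entries `none` are removed (meaningful if infinitely
many entries are not silent). -/
def removeSilent (v : ℕ → Option ℤ) (n : ℕ) : ℤ :=
  (v (Nat.nth (fun i => (v i).isSome) n)).getD 0

/-! ### Nested weighted automata -/

/-- A (non-deterministic) nested weighted automaton over the alphabet `Fin k`: a master automaton,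
whose labels are the indices of slave automata, and slave automata, which are weighted automata
over finite words. The value functions of master and slaves are arguments of the semantics. -/
structure NWA (k : ℕ) where
  numSlaves : ℕ
  master : LabeledAutomaton k (Fin numSlaves)
  slave : Fin numSlaves → LabeledAutomaton k ℤ

namespace NWA

variable {k : ℕ}

/-- A run on the infinite word `w`: a run of the master and, for every position `i`, a run of the
slave invoked at position `i` on the finite subword `w i, …, w (i + len i - 1)`. -/
structure Run (A : NWA k) (w : ℕ → Fin k) where
  master : A.master.InfRun w
  len : ℕ → ℕ
  slave : ∀ i, (A.slave (master.label i)).FinRun (fun j : Fin (len i) => w (i + j))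

/-- A run is accepting if the run of the master and all runs of slaves are accepting and infinitely
many runs of slaves are on non-empty words. -/
def Run.Accepting {A : NWA k} {w : ℕ → Fin k} (r : A.Run w) : Prop :=
  r.master.Accepting ∧ (∀ i, (r.slave i).Accepting) ∧ ∃ᶠ i in atTop, 0 < r.len i

/-- The value of a run of an `(f; g)`-automaton. -/
def Run.value {A : NWA k} {w : ℕ → Fin k} (f : (ℕ → ℤ) → EReal) (g : List ℤ → ℤ)
    (r : A.Run w) : EReal :=
  f (removeSilent fun i => (r.slave i).value g)

/-- The value of a word in an `(f; g)`-automaton: the infimum of the values of all accepting runs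
(`⊤` if there is none). -/
def value (f : (ℕ → ℤ) → EReal) (g : List ℤ → ℤ) (A : NWA k) (w : ℕ → Fin k) : EReal :=
  ⨅ (r : A.Run w) (_ : r.Accepting), r.value f g

/-- The value of a word in a `(LimSup; Sum)`-automaton. -/
def limSupSumValue (A : NWA k) (w : ℕ → Fin k) : EReal := A.value limSupValue sumValue w

/-- The word `w` is accepted: it has an accepting run. -/
def Accepts (A : NWA k) (w : ℕ → Fin k) : Prop := ∃ r : A.Run w, r.Accepting

/-- The slave invoked at position `i` is active at position `p`, i.e. it reads the letter at `p`. -/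
def Run.ActiveAt {A : NWA k} {w : ℕ → Fin k} (r : A.Run w) (i p : ℕ) : Prop :=
  i ≤ p ∧ p < i + r.len i

/-- Width bounded by `C`: in every run, at every position, at most `C` slaves are active. -/
def HasWidth (A : NWA k) (C : ℕ) : Prop :=
  ∀ (w : ℕ → Fin k) (r : A.Run w) (p : ℕ), {i | r.ActiveAt i p}.ncard ≤ C

end NWA

/-! ### Labeled Markov chains -/

/-- A labeled Markov chain over the alphabet `Fin k` with rational edge probabilities. -/
structure MarkovChain (k : ℕ) where
  numStates : ℕ
  init : Fin numStates
  edge : Fin numStates → Fin k → Fin numStates → ℚ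
  edge_nonneg : ∀ s a t, 0 ≤ edge s a t
  edge_sum : ∀ s, ∑ a, ∑ t, edge s a t = 1

namespace MarkovChain

variable {k : ℕ}

/-- The law of the next edge (its letter and its target) from the state `s`. -/
def step (M : MarkovChain k) (s : Fin M.numStates) : PMF (Fin k × Fin M.numStates) :=
  PMF.ofFintype (fun x => ENNReal.ofReal (M.edge s x.1 x.2 : ℝ)) (by
    rw [← ENNReal.ofReal_sum_of_nonneg fun x _ => by exact_mod_cast M.edge_nonneg s x.1 x.2,
      Fintype.sum_prod_type]
    have h := M.edge_sum s
    have h' : ∑ a, ∑ t, (M.edge s a t : ℝ) = 1 := by exact_mod_cast h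
    simp [h'])

/-- The transition kernel of the process of traversed edges: the next edge is drawn from the target
of the last one. -/
def kernel (M : MarkovChain k) (n : ℕ) :
    Kernel (Π _ : Finset.Iic n, Fin k × Fin M.numStates) (Fin k × Fin M.numStates) :=
  (Kernel.ofFunOfCountable fun s => (M.step s).toMeasure).comap
    (fun x => (x ⟨n, Finset.mem_Iic.2 le_rfl⟩).2) (by fun_prop)

instance (M : MarkovChain k) (n : ℕ) : IsMarkovKernel (M.kernel n) :=
  ⟨fun x => by
    change IsProbabilityMeasure (M.step (x ⟨n, Finset.mem_Iic.2 le_rfl⟩).2).toMeasure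
    infer_instance⟩

/-- The law of the infinite sequence of edges traversed by the chain from its initial state. -/
def pathMeasure (M : MarkovChain k) : Measure (ℕ → Fin k × Fin M.numStates) :=
  Kernel.trajMeasure (X := fun _ => Fin k × Fin M.numStates) (M.step M.init).toMeasure M.kernel

/-- The probability measure on infinite words given by the chain: the law of the sequence of
letters on the traversed edges. -/
def wordMeasure (M : MarkovChain k) : Measure (ℕ → Fin k) :=
  M.pathMeasure.map fun x n => (x n).1

/-- The one-state chain that generates the uniform distribution on infinite words over `{0, 1}`. -/
def uniformBinary : MarkovChain 2 where
  numStates := 1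
  init := 0
  edge _ _ _ := 1 / 2
  edge_nonneg _ _ _ := by norm_num
  edge_sum _ := by norm_num

end MarkovChain

/-! ### Finite descriptions as inputs of algorithms -/

/-- A rational number as a pair of numerator and denominator. -/
abbrev RatCode := ℤ × ℕ

def encodeRat (q : ℚ) : RatCode := (q.num, q.den)

/-- The rational number described by a pair of numerator and denominator. -/
def decodeRat (c : RatCode) : ℚ := (c.1 : ℚ) / (c.2 : ℚ)

/-- The table of a finite function of three arguments. -/
def table {l m n : ℕ} {Y : Type} (f : Fin l → Fin m → Fin n → Y) : List (List (List Y)) :=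
  (List.finRange l).map fun a => (List.finRange m).map fun b => (List.finRange n).map fun c => f a b c

/-- Number of states, characteristic vectors of the initial and of the accepting states, table of
the labeled transition relation. -/
abbrev AutomatonCode (Y : Type) := ℕ × List Bool × List Bool × List (List (List (Option Y)))

def LabeledAutomaton.encode {k : ℕ} {X Y : Type} (e : X → Y) (A : LabeledAutomaton k X) :
    AutomatonCode Y :=
  (A.numStates,
    (List.finRange A.numStates).map fun q => decide (q ∈ A.init),
    (List.finRange A.numStates).map fun q => decide (q ∈ A.accept),
    table fun q a q' => (A.delta q a q').map e)

/-- Size of the alphabet, master automaton, list of slave automata. -/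
abbrev NWACode := ℕ × AutomatonCode ℕ × List (AutomatonCode ℤ)

def NWA.encode {k : ℕ} (A : NWA k) : NWACode :=
  (k, A.master.encode Fin.val, (List.finRange A.numSlaves).map fun i => (A.slave i).encode id)

/-- Number of states, initial state, table of the edge probabilities. -/
abbrev MarkovChainCode := ℕ × ℕ × List (List (List RatCode))

def MarkovChain.encode {k : ℕ} (M : MarkovChain k) : MarkovChainCode :=
  (M.numStates, M.init, table fun s a t => encodeRat (M.edge s a t))

/-- The computational problem with inputs `x : ι`, presented as `enc x`, under the promise
`valid x`, where `correct x y` says that `y` is a correct output for `x`, is algorithmically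
solvable: some partial computable function halts with a correct output on every valid input. (On
other inputs it may diverge or return anything.) -/
def Solvable {ι α β : Type} [Primcodable α] [Primcodable β] (enc : ι → α) (valid : ι → Prop)
    (correct : ι → β → Prop) : Prop :=
  ∃ f : α →. β, Partrec f ∧ ∀ x, valid x → ∃ y ∈ f (enc x), correct x y

/-! ### Probabilistic questions -/

/-- An input of the probabilistic questions: an automaton and a Markov chain over the same
alphabet. -/
structure Instance where
  k : ℕ
  aut : NWA k
  chain : MarkovChain k

namespace Instance

def encode (x : Instance) : NWACode × MarkovChainCode := (x.aut.encode, x.chain.encode)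

/-- The random variable defined by the automaton, read as a `(LimSup; Sum)`-automaton. -/
def value (x : Instance) (w : ℕ → Fin x.k) : EReal := x.aut.limSupSumValue w

/-- The expected value exists, is finite and equals `e`. -/
def HasExpectedValue (x : Instance) (e : ℝ) : Prop :=
  (∀ᵐ w ∂x.chain.wordMeasure, x.value w ≠ ⊤ ∧ x.value w ≠ ⊥) ∧
    Integrable (fun w => (x.value w).toReal) x.chain.wordMeasure ∧
    ∫ w, (x.value w).toReal ∂x.chain.wordMeasure = e

/-- The cumulative distribution function. -/
def distribution (x : Instance) (t : ℝ) : ℝ :=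
  x.chain.wordMeasure.real {w | x.value w ≤ (t : EReal)}

/-- The instances in which the automaton has width (at most) `1` and accepts almost all words. -/
def widthOne : Set Instance :=
  {x | x.aut.HasWidth 1 ∧ ∀ᵐ w ∂x.chain.wordMeasure, x.aut.Accepts w}

/-- The instances of `widthOne` whose Markov chain is the one-state chain of the uniform
distribution on infinite words over `{0, 1}`. -/
def widthOneUniform : Set Instance :=
  {x ∈ widthOne | ∃ A : NWA 2, x = ⟨2, A, MarkovChain.uniformBinary⟩}

end Instance

/-- The expected question on the class `C`: compute the expected value exactly, as a rational
number, on those instances where it is a rational number. -/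
def ExpectedQuestion (C : Set Instance) : Prop :=
  Solvable Instance.encode
    (fun x => x ∈ C ∧ ∃ q : ℚ, x.HasExpectedValue q)
    (fun x c => x.HasExpectedValue (decodeRat c : ℚ))

/-- The distribution question on the class `C`: given a threshold, compute the value of the
distribution function exactly, as a rational number, whenever it is a rational number. -/
def DistributionQuestion (C : Set Instance) : Prop :=
  Solvable (fun x : Instance × ℚ => (x.1.encode, encodeRat x.2))
    (fun x => x.1 ∈ C ∧ ∃ q : ℚ, x.1.distribution x.2 = q)
    (fun x c => x.1.distribution x.2 = (decodeRat c : ℚ))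

/-- The approximate expected question on the class `C`: given `ε > 0`, compute a rational number
that is `ε`-close to the expected value, on those instances where the latter is finite. -/
def ApproxExpectedQuestion (C : Set Instance) : Prop :=
  Solvable (fun x : Instance × ℚ => (x.1.encode, encodeRat x.2))
    (fun x => x.1 ∈ C ∧ 0 < x.2 ∧ ∃ e : ℝ, x.1.HasExpectedValue e)
    (fun x c => ∃ e : ℝ, x.1.HasExpectedValue e ∧ |((decodeRat c : ℚ) : ℝ) - e| ≤ x.2)

/-- The approximate distribution question on the class `C`: given a threshold and `ε > 0`, compute
a rational number that is `ε`-close to the value of the distribution function. -/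
def ApproxDistributionQuestion (C : Set Instance) : Prop :=
  Solvable (fun x : Instance × ℚ × ℚ => (x.1.encode, encodeRat x.2.1, encodeRat x.2.2))
    (fun x => x.1 ∈ C ∧ 0 < x.2.2)
    (fun x c => |((decodeRat c : ℚ) : ℝ) - x.1.distribution x.2.1| ≤ x.2.2)

/-- The almost-sure distribution question on the class `C`: given a threshold, decide whether the
value of the distribution function is exactly `1`. -/
def AlmostSureQuestion (C : Set Instance) : Prop :=
  Solvable (fun x : Instance × ℚ => (x.1.encode, encodeRat x.2))
    (fun x => x.1 ∈ C)
    (fun x (b : Bool) => b = true ↔ x.1.distribution x.2 = 1)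

/-- Given a `(LimSup; Sum)`-automaton of width `1` over `{0, 1}` such that, under the uniform
distribution, almost all words have value `0` or almost all words have value `-1`, decide which of
the two is the case. -/
def ZeroOrMinusOneQuestion : Prop :=
  Solvable (NWA.encode (k := 2))
    (fun A => A.HasWidth 1 ∧
      ((∀ᵐ w ∂MarkovChain.uniformBinary.wordMeasure, A.limSupSumValue w = 0) ∨
        ∀ᵐ w ∂MarkovChain.uniformBinary.wordMeasure, A.limSupSumValue w = -1))
    (fun A (b : Bool) =>
      b = true ↔ ∀ᵐ w ∂MarkovChain.uniformBinary.wordMeasure, A.limSupSumValue w = 0)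

end NWAProb

end

open NWAProb

/-! The proof reduces a halting problem to the comparison of the almost sure values 0 and -1.

A counter program is a regular language of increments, decrements and zero tests. It halts on `n` if
some word of the language can be executed legally with `n` in register 0. Loops compute all
primitive recursive functions and nondeterminism supplies an unbounded search, so for some fixed
program the set of inputs on which it halts is not computable (`exists_not_computablePred_haltsOn`).

For such a program and an input `n`, a binary word is read as a sequence of blocks, each coding a
word of instructions. The master decodes deterministically and starts one slave per block, which
ends where the block ends; this gives width 1. The slave guesses an error in the block. Either the
word is outside the regular language, at weight -1, or some occurrence of an instruction is illegal.
In the second case the slave adds up the changes of one register, so that its total is negative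
exactly if the guessed occurrence is illegal, provided that everything before it was legal
(`Check.offset_eq_drift_add`). The least weight on a block is therefore at least 0 if the block is a
halting computation, and at most -1 otherwise. It is always at most 0, and it is at least -1 on the
empty block.

Under the uniform distribution almost every word contains every block infinitely often
(`uniformBinary_ae_frequently_block`). The limit superior thus sees all blocks: the value is almost
surely 0 if a halting computation exists and -1 if not. Only some slave weights depend on `n`, so
the automaton is computable from `n` (`exists_undecidable_family`). Expectation and distribution
function at -1 differ by 1 between the two cases, hence even an answer with error 1/4 would decide
halting (`not_solvable_of_reduction`). -/

/-! ### Regular languages -/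

namespace Language

open scoped Computability

variable {α : Type*} {L M : Language α}

theorem mem_sSup {S : Set (Language α)} {x : List α} : x ∈ sSup S ↔ ∃ K ∈ S, x ∈ K := Iff.rfl

/-- The factor from `L` ends either after `x` or inside it. The right side depends only on one
quotient of `L` and a set of quotients of `M`, so regular factors leave finitely many possibilities
and Myhill–Nerode applies. -/
theorem leftQuotient_mul (L M : Language α) (x : List α) :
    (L * M).leftQuotient x =
      L.leftQuotient x * M + sSup {K | ∃ y ∈ L, ∃ z, y ++ z = x ∧ K = M.leftQuotient z} := by
  ext w
  rw [mem_add, mem_sSup, mem_leftQuotient, mem_mul, mem_mul]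
  constructor
  · rintro ⟨a, ha, b, hb, hab⟩
    rcases List.append_eq_append_iff.1 hab with ⟨c, rfl, rfl⟩ | ⟨c, rfl, rfl⟩
    · exact Or.inr ⟨_, ⟨a, ha, c, rfl, rfl⟩, hb⟩
    · exact Or.inl ⟨c, ha, b, hb, rfl⟩
  · rintro (⟨a, ha, b, hb, rfl⟩ | ⟨_, ⟨y, hy, z, rfl, rfl⟩, hw⟩)
    · exact ⟨x ++ a, ha, b, hb, by simp⟩
    · exact ⟨y, hy, z ++ w, hw, by simp⟩

theorem IsRegular.mul (hL : L.IsRegular) (hM : M.IsRegular) : (L * M).IsRegular := by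
  rw [isRegular_iff_finite_range_leftQuotient] at *
  refine (Set.Finite.image (fun p : Language α × Set (Language α) => p.1 * M + sSup p.2)
    (hL.prod hM.finite_subsets)).subset ?_
  rintro _ ⟨x, rfl⟩
  refine ⟨(L.leftQuotient x, {K | ∃ y ∈ L, ∃ z, y ++ z = x ∧ K = M.leftQuotient z}),
    ⟨⟨x, rfl⟩, ?_⟩, (leftQuotient_mul L M x).symm⟩
  rintro _ ⟨y, -, z, -, rfl⟩
  exact ⟨z, rfl⟩

theorem append_mem_kstar {x y : List α} (hx : x ∈ L∗) (hy : y ∈ L∗) : x ++ y ∈ L∗ := by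
  obtain ⟨X, rfl, hX⟩ := hx
  obtain ⟨Y, rfl, hY⟩ := hy
  exact ⟨X ++ Y, by simp, by simpa [or_imp, forall_and] using ⟨hX, hY⟩⟩

theorem mem_kstar_of_mem {x : List α} (hx : x ∈ L) : x ∈ L∗ := ⟨[x], by simp, by simpa⟩

@[elab_as_elim]
theorem kstar_induction {p : List α → Prop} (nil : p [])
    (append : ∀ x ∈ L, ∀ y ∈ L∗, p y → p (x ++ y)) {x : List α} (hx : x ∈ L∗) : p x := by
  obtain ⟨X, rfl, hX⟩ := hx
  induction X with
  | nil => exact nil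
  | cons a X ih =>
    rw [List.flatten_cons]
    simp only [List.mem_cons, forall_eq_or_imp] at hX
    exact append a hX.1 _ ⟨X, rfl, hX.2⟩ (ih hX.2)

/-- Cut the factorization at the factor in which `x` ends: `z` is the part of that factor inside
`x`. For empty `x` there need be no such factor, whence the hypothesis. -/
theorem leftQuotient_kstar (L : Language α) {x : List α} (hx : x ≠ []) :
    (L∗).leftQuotient x =
      sSup {K | ∃ y ∈ L∗, ∃ z, y ++ z = x ∧ K = L.leftQuotient z} * L∗ := by
  ext w
  simp only [mem_leftQuotient, mem_mul, mem_sSup]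
  constructor
  · intro h
    have key : ∀ u ∈ L∗, ∀ x, x ≠ [] → ∀ w, x ++ w = u → ∃ a,
        (∃ K ∈ {K | ∃ y ∈ L∗, ∃ z, y ++ z = x ∧ K = L.leftQuotient z}, a ∈ K) ∧
          ∃ b ∈ L∗, a ++ b = w := by
      intro u hu
      refine kstar_induction ?_ ?_ hu
      · intro x hx w h
        simp [hx] at h
      · intro c hc y hy ih x hx w h
        rcases List.append_eq_append_iff.1 h with ⟨d, rfl, rfl⟩ | ⟨d, rfl, rfl⟩
        · exact ⟨d, ⟨_, ⟨[], nil_mem_kstar _, x, rfl, rfl⟩, hc⟩, y, hy, rfl⟩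
        -- If `x` ends exactly with the factor `c`, then `z` is all of `c` and the remainder of the
        -- factor is empty; otherwise the cut lies in a later factor.
        · rcases eq_or_ne d [] with rfl | hd
          · exact ⟨[], ⟨_, ⟨[], nil_mem_kstar _, c, by simp, rfl⟩, by simpa using hc⟩, w, hy,
              by simp⟩
          · obtain ⟨a, ⟨_, ⟨y', hy', z, rfl, rfl⟩, ha⟩, b, hb, rfl⟩ := ih d hd w rfl
            exact ⟨a, ⟨_, ⟨c ++ y', append_mem_kstar (mem_kstar_of_mem hc) hy', z, by simp, rfl⟩,
              ha⟩, b, hb, rfl⟩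
    exact key _ h x hx w rfl
  · rintro ⟨a, ⟨_, ⟨y, hy, z, rfl, rfl⟩, ha⟩, b, hb, rfl⟩
    rw [show (y ++ z) ++ (a ++ b) = y ++ ((z ++ a) ++ b) by simp]
    exact append_mem_kstar hy (append_mem_kstar (mem_kstar_of_mem ha) hb)

theorem IsRegular.kstar (hL : L.IsRegular) : (L∗).IsRegular := by
  rw [isRegular_iff_finite_range_leftQuotient] at *
  refine ((Set.Finite.image (fun T : Set (Language α) => sSup T * L∗)
    hL.finite_subsets).union (Set.finite_singleton L∗)).subset ?_
  rintro _ ⟨x, rfl⟩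
  rcases eq_or_ne x [] with rfl | hx
  · right; simp
  refine Or.inl ⟨{K | ∃ y ∈ L∗, ∃ z, y ++ z = x ∧ K = L.leftQuotient z}, ?_,
    (leftQuotient_kstar L hx).symm⟩
  rintro _ ⟨y, -, z, -, rfl⟩
  exact ⟨z, rfl⟩

theorem isRegular_singleton (a : α) : ({[a]} : Language α).IsRegular := by
  rw [isRegular_iff_finite_range_leftQuotient]
  refine (Set.toFinite ({{[a]}, 1, 0} : Set (Language α))).subset ?_
  rintro _ ⟨x, rfl⟩
  rcases x with _ | ⟨b, x⟩
  · simp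
  · right
    by_cases h : b = a ∧ x = []
    · left
      obtain ⟨rfl, rfl⟩ := h
      ext w
      change [b] ++ w ∈ ({[b]} : Set (List α)) ↔ w ∈ ({[]} : Set (List α))
      simp
    · right
      ext w
      change (b :: x) ++ w ∈ ({[a]} : Set (List α)) ↔ w ∈ (∅ : Set (List α))
      simp
      tauto

theorem isRegular_one : (1 : Language α).IsRegular := by
  rw [isRegular_iff_finite_range_leftQuotient]
  refine (Set.toFinite ({1, 0} : Set (Language α))).subset ?_
  rintro _ ⟨x, rfl⟩
  rcases x with _ | ⟨b, x⟩
  · simp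
  · right
    ext w
    change (b :: x) ++ w ∈ ({[]} : Set (List α)) ↔ w ∈ (∅ : Set (List α))
    simp

end Language

namespace NWAProb

/-! ### The uniform distribution on binary words -/

/-- Constant kernels make the steps independent. Both measures are projective limits of the same
finite products, and such a limit is unique. -/
theorem trajMeasure_const {X : Type*} [MeasurableSpace X] (ν : Measure X) [IsProbabilityMeasure ν] :
    Kernel.trajMeasure (X := fun _ => X) ν (fun _ => Kernel.const _ ν) =
      Measure.infinitePi fun _ : ℕ => ν := by
  have h : Kernel.trajMeasure (X := fun _ => X) ν (fun _ => Kernel.const _ ν) =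
      Measure.infinitePiNat fun _ : ℕ => ν := by
    rw [Kernel.trajMeasure, Measure.infinitePiNat]
    congr 1
    refine (Measure.pi_eq fun s hs => ?_).symm
    rw [Measure.map_apply (by fun_prop) (.univ_pi hs)]
    rw [Fintype.prod_unique]
    congr 1
    ext x
    simp only [Set.mem_preimage, Set.mem_pi, Set.mem_univ, forall_const, Unique.forall_iff]
    rfl
  rw [h]
  exact (Measure.isProjectiveLimit_infinitePiNat _).unique (Measure.isProjectiveLimit_infinitePi _)

theorem uniformBinary_kernel (n : ℕ) : MarkovChain.uniformBinary.kernel n =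
    Kernel.const _ (MarkovChain.uniformBinary.step MarkovChain.uniformBinary.init).toMeasure := by
  ext x s hs
  simp only [MarkovChain.kernel]
  rw [Kernel.comap_apply, Kernel.const_apply]
  congr 1

theorem uniformBinary_wordMeasure_eq :
    MarkovChain.uniformBinary.wordMeasure =
      Measure.infinitePi fun _ : ℕ =>
        ((MarkovChain.uniformBinary.step MarkovChain.uniformBinary.init).toMeasure.map Prod.fst :
          Measure (Fin 2)) := by
  rw [MarkovChain.wordMeasure, MarkovChain.pathMeasure]
  have h : MarkovChain.uniformBinary.kernel =
      fun n => Kernel.const _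
        (MarkovChain.uniformBinary.step MarkovChain.uniformBinary.init).toMeasure :=
    funext uniformBinary_kernel
  simp only [h]
  rw [trajMeasure_const, Measure.infinitePi_map_pi (f := fun _ => Prod.fst) _ (by fun_prop)]

theorem uniformBinary_step_fst_singleton_ne_zero (a : Fin 2) :
    (MarkovChain.uniformBinary.step MarkovChain.uniformBinary.init).toMeasure.map Prod.fst {a}
      ≠ 0 := by
  rw [Measure.map_apply (by fun_prop) (measurableSet_singleton a)]
  refine ne_of_gt (lt_of_lt_of_le ?_ (measure_mono
    (Set.singleton_subset_iff.2 (Set.mem_preimage.2 (Set.mem_singleton a)) :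
      {(a, MarkovChain.uniformBinary.init)} ⊆ Prod.fst ⁻¹' {a})))
  rw [PMF.toMeasure_apply_singleton _ _ (measurableSet_singleton _)]
  change 0 < ENNReal.ofReal (((1 / 2 : ℚ) : ℚ) : ℝ)
  norm_num

/-- In an i.i.d. sequence in which `a` has positive probability for every `a`, every finite pattern
occurs infinitely often. -/
theorem ae_frequently_pattern {X : Type*} [MeasurableSpace X] [MeasurableSingletonClass X]
    (ν : Measure X) [IsProbabilityMeasure ν] (hν : ∀ a, ν {a} ≠ 0) (v : List X) :
    ∀ᵐ w ∂(Measure.infinitePi fun _ : ℕ => ν),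
      ∃ᶠ i in atTop, ∀ j (h : j < v.length), w (i + j) = v[j] := by
  set μ := Measure.infinitePi fun _ : ℕ => ν
  rcases eq_or_ne v [] with rfl | hv
  · refine ae_of_all _ fun w => Frequently.of_forall fun i j h => ?_
    simp at h
  have hL : 0 < v.length := List.length_pos_iff.2 hv
  let t : ℕ → Set X := fun i => {v[i % v.length]'(Nat.mod_lt _ hL)}
  have ht : ∀ i, MeasurableSet (t i) := fun i => measurableSet_singleton _
  -- Disjoint windows of length `v.length`: the events that `v` fills the `k`-th window are
  -- independent and equally likely, with positive probability, so the second Borel–Cantelli lemma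
  -- applies.
  let I : ℕ → Finset ℕ := fun k => Finset.Ico (k * v.length) (k * v.length + v.length)
  have hI : ∀ i k, i ∈ I k ↔ i / v.length = k := by
    intro i k
    simp only [I, Finset.mem_Ico]
    rw [Nat.div_eq_iff hL]
    have := Nat.sub_add_cancel hL
    constructor <;> rintro ⟨h1, h2⟩ <;> constructor <;> lia
  let s : ℕ → Set (ℕ → X) := fun k => Set.pi (I k) t
  have hsm : ∀ k, MeasurableSet (s k) := fun k =>
    MeasurableSet.pi (Finset.countable_toSet _) fun i _ => ht i
  have hs : ∀ k, μ (s k) = ∏ i ∈ I k, ν (t i) := fun k =>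
    Measure.infinitePi_pi _ fun i _ => ht i
  have hind : iIndepSet s μ := by
    rw [iIndepSet_iff_meas_biInter hsm]
    intro S
    have h1 : (⋂ k ∈ S, s k) = Set.pi (S.biUnion I : Finset ℕ) t := by
      ext w
      simp only [s, Set.mem_iInter, Set.mem_pi, Finset.mem_coe, Finset.mem_biUnion]
      exact ⟨fun h i ⟨k, hk, hi⟩ => h k hk i hi, fun h k hk i hi => h i ⟨k, hk, hi⟩⟩
    rw [h1, Measure.infinitePi_pi _ fun i _ => ht i, Finset.prod_biUnion]
    · exact Finset.prod_congr rfl fun k _ => (hs k).symm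
    · intro a _ b _ hab
      refine Finset.disjoint_left.2 fun i hi hi' => hab ?_
      rw [← (hI _ _).1 hi, ← (hI _ _).1 hi']
  have hconst : ∀ k, μ (s k) = μ (s 0) := by
    intro k
    rw [hs, hs]
    simp only [I, Finset.prod_Ico_eq_prod_range, t]
    simp
  have hpos : μ (s 0) ≠ 0 := by
    rw [hs, Finset.prod_ne_zero_iff]
    exact fun i _ => hν _
  have hlim := measure_limsup_eq_one hsm hind (by
    simp_rw [hconst]
    exact ENNReal.tsum_const_eq_top_of_ne_zero hpos)
  have hae : ∀ᵐ w ∂μ, w ∈ limsup s atTop := by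
    change limsup s atTop ∈ ae μ
    rw [mem_ae_iff_prob_eq_one (MeasurableSet.measurableSet_limsup hsm)]
    exact hlim
  filter_upwards [hae] with w hw
  rw [mem_limsup_iff_frequently_mem] at hw
  rw [frequently_atTop] at hw ⊢
  intro a
  obtain ⟨k, hk, hwk⟩ := hw a
  refine ⟨k * v.length, hk.trans (Nat.le_mul_of_pos_right _ hL), fun j hj => ?_⟩
  have := hwk (k * v.length + j) (by simpa [I] using hj)
  simpa [t, Nat.mod_eq_of_lt hj] using this

theorem uniformBinary_ae_frequently_pattern :
    ∀ᵐ w ∂MarkovChain.uniformBinary.wordMeasure, ∀ v : List (Fin 2),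
      ∃ᶠ i in atTop, ∀ j (h : j < v.length), w (i + j) = v[j] := by
  rw [ae_all_iff, uniformBinary_wordMeasure_eq]
  intro v
  have : IsProbabilityMeasure
      ((MarkovChain.uniformBinary.step MarkovChain.uniformBinary.init).toMeasure.map Prod.fst :
        Measure (Fin 2)) :=
    Measure.isProbabilityMeasure_map (by fun_prop)
  exact ae_frequently_pattern _ uniformBinary_step_fst_singleton_ne_zero v

instance : IsProbabilityMeasure MarkovChain.uniformBinary.wordMeasure := by
  unfold MarkovChain.wordMeasure MarkovChain.pathMeasure
  exact Measure.isProbabilityMeasure_map (Measurable.aemeasurable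
    (measurable_pi_lambda _ fun n => measurable_fst.comp (measurable_pi_apply n)))

open scoped Computability

/-! ### Counter programs -/

/-- The instructions of a counter program: increment, decrement (enabled if the register is
positive) and zero test (enabled if the register is zero). -/
inductive CounterOp
  | inc (r : ℕ)
  | dec (r : ℕ)
  | zero (r : ℕ)
deriving DecidableEq

namespace CounterOp

def step : CounterOp → (ℕ → ℕ) → Option (ℕ → ℕ)
  | inc r, σ => some (Function.update σ r (σ r + 1))
  | dec r, σ => if σ r = 0 then none else some (Function.update σ r (σ r - 1))
  | zero r, σ => if σ r = 0 then some σ else none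

def run : List CounterOp → (ℕ → ℕ) → Option (ℕ → ℕ)
  | [], σ => some σ
  | a :: u, σ => (step a σ).bind (run u)

theorem run_append (u v : List CounterOp) (σ : ℕ → ℕ) :
    run (u ++ v) σ = (run u σ).bind (run v) := by
  induction u generalizing σ with
  | nil => rfl
  | cons a u ih =>
    simp only [List.cons_append, run, Option.bind_assoc]
    congr 1
    exact funext ih

end CounterOp

open CounterOp

/-- A non-deterministic counter program: a regular language of instruction sequences that uses
finitely many instructions. -/
structure CounterProgram where
  lang : Language CounterOp
  regular : lang.IsRegular
  ops : Finset CounterOp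
  mem_ops : ∀ u ∈ lang, ∀ a ∈ u, a ∈ ops

namespace CounterProgram

/-- The input-output relation of a counter program. -/
def Rel (p : CounterProgram) (σ τ : ℕ → ℕ) : Prop := ∃ u ∈ p.lang, run u σ = some τ

def skip : CounterProgram where
  lang := 1
  regular := Language.isRegular_one
  ops := ∅
  mem_ops := by
    rintro u (rfl : u = []) a ha
    simp at ha

def single (a : CounterOp) : CounterProgram where
  lang := {[a]}
  regular := Language.isRegular_singleton a
  ops := {a}
  mem_ops := by
    rintro u (rfl : u = [a]) b hb
    simpa using hb

def seq (p q : CounterProgram) : CounterProgram where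
  lang := p.lang * q.lang
  regular := p.regular.mul q.regular
  ops := p.ops ∪ q.ops
  mem_ops := by
    rintro _ ⟨u, hu, v, hv, rfl⟩ a ha
    rcases List.mem_append.1 ha with ha | ha
    · exact Finset.mem_union_left _ (p.mem_ops u hu a ha)
    · exact Finset.mem_union_right _ (q.mem_ops v hv a ha)

def star (p : CounterProgram) : CounterProgram where
  lang := (p.lang∗)
  regular := p.regular.kstar
  ops := p.ops
  mem_ops := by
    rintro _ ⟨U, rfl, hU⟩ a ha
    obtain ⟨u, hu, ha⟩ := List.mem_flatten.1 ha
    exact p.mem_ops u (hU u hu) a ha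

/-! ### Input-output relations of the program constructors -/

variable {p q : CounterProgram} {σ τ : ℕ → ℕ}

theorem rel_skip : skip.Rel σ τ ↔ τ = σ := by
  constructor
  · rintro ⟨u, (rfl : u = []), h⟩
    exact (Option.some.inj h).symm
  · rintro rfl
    exact ⟨[], rfl, rfl⟩

theorem rel_single {a : CounterOp} : (single a).Rel σ τ ↔ step a σ = some τ := by
  constructor
  · rintro ⟨u, (rfl : u = [a]), h⟩
    simpa [run] using h
  · intro h
    exact ⟨[a], rfl, by simpa [run] using h⟩

theorem rel_seq : (seq p q).Rel σ τ ↔ ∃ ρ, p.Rel σ ρ ∧ q.Rel ρ τ := by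
  constructor
  · rintro ⟨_, ⟨u, hu, v, hv, rfl⟩, h⟩
    rw [run_append, Option.bind_eq_some_iff] at h
    obtain ⟨ρ, h1, h2⟩ := h
    exact ⟨ρ, ⟨u, hu, h1⟩, v, hv, h2⟩
  · rintro ⟨ρ, ⟨u, hu, h1⟩, v, hv, h2⟩
    exact ⟨u ++ v, ⟨u, hu, v, hv, rfl⟩, by simp [run_append, h1, h2]⟩

theorem rel_star : p.star.Rel σ τ ↔ Relation.ReflTransGen p.Rel σ τ := by
  constructor
  · rintro ⟨u, hu, h⟩
    refine Language.kstar_induction (L := p.lang)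
      (p := fun u => ∀ σ, run u σ = some τ → Relation.ReflTransGen p.Rel σ τ) ?_ ?_ hu σ h
    · intro σ h
      rw [Option.some.inj h]
    · intro u hu v _ ih σ h
      rw [run_append, Option.bind_eq_some_iff] at h
      obtain ⟨ρ, h1, h2⟩ := h
      exact .head ⟨u, hu, h1⟩ (ih ρ h2)
  · intro h
    induction h with
    | refl => exact ⟨[], Language.nil_mem_kstar _, rfl⟩
    | tail _ h ih =>
      obtain ⟨u, hu, hu'⟩ := ih
      obtain ⟨v, hv, hv'⟩ := h
      exact ⟨u ++ v, Language.append_mem_kstar hu (Language.mem_kstar_of_mem hv),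
        by simp [run_append, hu', hv']⟩

/-- The final zero test forbids leaving the star early, and the decrement forbids another round once
`a` is zero; so the number of rounds is not a free choice. -/
def loop (a : ℕ) (p : CounterProgram) : CounterProgram :=
  seq (star (seq (single (dec a)) p)) (single (zero a))

theorem rel_inc {r : ℕ} : (single (inc r)).Rel σ τ ↔ τ = Function.update σ r (σ r + 1) := by
  rw [rel_single, step, Option.some.injEq, eq_comm]

theorem rel_zero {r : ℕ} : (single (zero r)).Rel σ τ ↔ σ r = 0 ∧ τ = σ := by
  rw [rel_single, step]
  split_ifs with h <;> simp [h, eq_comm]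

theorem rel_dec {r : ℕ} :
    (single (dec r)).Rel σ τ ↔ σ r ≠ 0 ∧ τ = Function.update σ r (σ r - 1) := by
  rw [rel_single, step]
  split_ifs with h <;> simp [h, eq_comm]

theorem rel_loop_of_eq_zero {a : ℕ} (h : σ a = 0) : (loop a p).Rel σ τ ↔ τ = σ := by
  rw [loop, rel_seq]
  simp only [rel_star, rel_zero]
  constructor
  · rintro ⟨ρ, h1, h2, rfl⟩
    rcases h1.cases_head with h1 | ⟨ρ', h1, -⟩
    · exact h1.symm
    · obtain ⟨_, h1, -⟩ := rel_seq.1 h1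
      exact absurd h (rel_dec.1 h1).1
  · rintro rfl
    exact ⟨τ, .refl, h, rfl⟩

theorem rel_loop_of_ne_zero {a : ℕ} (h : σ a ≠ 0) : (loop a p).Rel σ τ ↔
    ∃ ρ, p.Rel (Function.update σ a (σ a - 1)) ρ ∧ (loop a p).Rel ρ τ := by
  simp only [loop, rel_seq, rel_star, rel_zero]
  constructor
  · rintro ⟨ρ, h1, h2, rfl⟩
    rcases h1.cases_head with rfl | ⟨ρ', h1, h3⟩
    · exact absurd h2 h
    · obtain ⟨_, h1, h4⟩ := rel_seq.1 h1
      obtain ⟨-, rfl⟩ := rel_dec.1 h1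
      exact ⟨ρ', h4, τ, h3, h2, rfl⟩
  · rintro ⟨ρ', h4, ρ, h3, h2, rfl⟩
    exact ⟨τ, .head (rel_seq.2 ⟨_, rel_dec.2 ⟨h, rfl⟩, h4⟩) h3, h2, rfl⟩

/-- Here `s k` is the memory after `k` rounds, a loop invariant given explicitly. The proof is an
induction on the number of rounds left. -/
theorem rel_loop {a n : ℕ} (s : ℕ → ℕ → ℕ) (ha : ∀ k ≤ n, s k a = n - k)
    (hs : ∀ k < n, ∀ τ, p.Rel (Function.update (s k) a (n - k - 1)) τ ↔ τ = s (k + 1)) :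
    (loop a p).Rel (s 0) τ ↔ τ = s n := by
  have key : ∀ j k, k + j = n → ((loop a p).Rel (s k) τ ↔ τ = s n) := by
    intro j
    induction j with
    | zero =>
      rintro k rfl
      exact rel_loop_of_eq_zero (by simp [ha])
    | succ j ih =>
      intro k hk
      have h := ha k (by lia)
      rw [rel_loop_of_ne_zero (by lia), h]
      simp only [hs k (by lia)]
      rw [← ih (k + 1) (by lia)]
      exact exists_eq_left
  exact key n 0 (Nat.zero_add n)

/-- Set register `a` to zero. -/
def clear (a : ℕ) : CounterProgram := loop a skip

theorem rel_clear {a : ℕ} : (clear a).Rel σ τ ↔ τ = Function.update σ a 0 := by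
  have := rel_loop (p := skip) (τ := τ) (a := a) (n := σ a)
    (fun k => Function.update σ a (σ a - k)) (by simp)
    (fun k hk τ => by rw [rel_skip, Function.update_idem]; rfl)
  simpa [clear] using this

/-- Add register `a` to register `o` and set register `a` to zero. -/
def move (a o : ℕ) : CounterProgram := loop a (single (inc o))

theorem rel_move {a o : ℕ} (hao : a ≠ o) : (move a o).Rel σ τ ↔
    τ = Function.update (Function.update σ a 0) o (σ o + σ a) := by
  have := rel_loop (p := single (inc o)) (τ := τ) (a := a) (n := σ a)
    (fun k => Function.update (Function.update σ a (σ a - k)) o (σ o + k)) (by simp [hao])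
    (fun k hk τ => by
      rw [rel_inc]
      refine Eq.congr_right ?_
      funext r
      simp only [Function.update_apply]
      split_ifs <;> simp_all <;> lia)
  simpa [move] using this

/-- Add register `a` to register `o`, using `t` as an auxiliary register. -/
def copy (a o t : ℕ) : CounterProgram :=
  seq (loop a (seq (single (inc o)) (single (inc t)))) (move t a)

/-- Reading a register destroys it, so its content is sent to both `o` and `t` and then restored
from `t`. -/
theorem rel_copy {a o t : ℕ} (hao : a ≠ o) (hat : a ≠ t) (hot : o ≠ t) (ht : σ t = 0) :
    (copy a o t).Rel σ τ ↔ τ = Function.update σ o (σ o + σ a) := by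
  have := fun τ => rel_loop (p := seq (single (inc o)) (single (inc t))) (τ := τ) (a := a)
    (n := σ a)
    (fun k r => if r = a then σ a - k else if r = o then σ o + k else if r = t then k else σ r)
    (by simp)
    (fun k hk τ => by
      simp only [rel_seq, rel_inc, exists_eq_left]
      refine Eq.congr_right ?_
      funext r
      simp only [Function.update_apply]
      split_ifs <;> simp_all <;> lia)
  have h0 : (fun r => if r = a then σ a - 0 else if r = o then σ o + 0 else if r = t then 0
      else σ r) = σ := by
    funext r
    split_ifs <;> simp_all
  rw [h0] at this
  simp only [copy, rel_seq, this, rel_move hat.symm, exists_eq_left]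
  refine Eq.congr_right ?_
  funext r
  simp only [Function.update_apply]
  split_ifs <;> simp_all

/-- Set the registers `b, …, b + k - 1` to zero. -/
theorem exists_rel_clear_block (b k : ℕ) : ∃ p : CounterProgram, ∀ σ τ, p.Rel σ τ ↔
    τ = fun r => if b ≤ r ∧ r < b + k then 0 else σ r := by
  induction k with
  | zero =>
    refine ⟨skip, fun σ τ => ?_⟩
    rw [rel_skip]
    refine Eq.congr_right ?_
    funext r
    rw [if_neg (by lia)]
  | succ k ih =>
    obtain ⟨p, hp⟩ := ih
    refine ⟨seq p (clear (b + k)), fun σ τ => ?_⟩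
    simp only [rel_seq, hp, rel_clear, exists_eq_left]
    refine Eq.congr_right ?_
    funext r
    simp only [Function.update_apply]
    split_ifs <;> first | rfl | lia

/-! ### Primitive recursive functions computed by counter programs -/

/-- The program `p` adds `f` of the registers `ins` to the register `o`, which must be zero before,
and uses registers from `b` on, which must be zero before and are zero again afterwards. -/
def Computes {n : ℕ} (p : CounterProgram) (f : List.Vector ℕ n → ℕ) (ins : Fin n → ℕ)
    (o b : ℕ) : Prop :=
  ∀ σ, (∀ r, b ≤ r → σ r = 0) → σ o = 0 → ∀ τ,
    p.Rel σ τ ↔ τ = Function.update σ o (f (List.Vector.ofFn fun i => σ (ins i)))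

/-- The values are computed one by one. Each component takes its scratch registers from `b + n` on,
beyond all the result registers, so earlier results survive. -/
theorem exists_computes_block {m n : ℕ} (g : Fin n → List.Vector ℕ m → ℕ)
    (hg : ∀ i, ∀ (ins : Fin m → ℕ) (o b : ℕ), (∀ i, ins i < b) → o < b → (∀ i, ins i ≠ o) →
      ∃ p : CounterProgram, p.Computes (g i) ins o b)
    (ins : Fin m → ℕ) (b : ℕ) (hins : ∀ i, ins i < b) (k : ℕ) (hk : k ≤ n) :
    ∃ p : CounterProgram, ∀ σ, (∀ r, b ≤ r → σ r = 0) → ∀ τ, p.Rel σ τ ↔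
      τ = fun r => if h : b ≤ r ∧ r < b + k then
        g ⟨r - b, by lia⟩ (List.Vector.ofFn fun i => σ (ins i)) else σ r := by
  induction k with
  | zero =>
    refine ⟨skip, fun σ _ τ => ?_⟩
    rw [rel_skip]
    refine Eq.congr_right ?_
    funext r
    rw [dif_neg (by lia)]
  | succ k ih =>
    obtain ⟨p, hp⟩ := ih (by lia)
    obtain ⟨q, hq⟩ := hg ⟨k, by lia⟩ ins (b + k) (b + n) (fun i => by have := hins i; lia)
      (by lia) (fun i => by have := hins i; lia)
    refine ⟨seq p q, fun σ hσ τ => ?_⟩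
    simp only [rel_seq, hp σ hσ, exists_eq_left]
    rw [hq _ (fun r hr => by rw [dif_neg (by lia)]; exact hσ r (by lia))
      (by rw [dif_neg (by lia)]; exact hσ _ (by lia))]
    refine Eq.congr_right ?_
    have h1 : ∀ i, ¬ (b ≤ ins i ∧ ins i < b + k) := fun i => by have := hins i; lia
    funext r
    simp only [Function.update_apply, h1, dite_false]
    by_cases hr : r = b + k
    · subst hr
      simp
    · rw [if_neg hr]
      by_cases h : b ≤ r ∧ r < b + k
      · rw [dif_pos h, dif_pos (by lia)]
      · rw [dif_neg h, dif_neg (by lia)]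

theorem exists_computes {n : ℕ} {f : List.Vector ℕ n → ℕ} (hf : Nat.Primrec' f) :
    ∀ (ins : Fin n → ℕ) (o b : ℕ), (∀ i, ins i < b) → o < b → (∀ i, ins i ≠ o) →
      ∃ p : CounterProgram, p.Computes f ins o b := by
  induction hf with
  | zero =>
    intro ins o b _ _ _
    refine ⟨skip, fun σ _ ho τ => ?_⟩
    rw [rel_skip]
    refine Eq.congr_right ?_
    rw [Function.eq_update_iff]
    exact ⟨ho, fun _ _ => rfl⟩
  | succ =>
    intro ins o b hi ho hio
    refine ⟨seq (copy (ins 0) o b) (single (inc o)), fun σ hb h0 τ => ?_⟩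
    simp only [rel_seq, rel_copy (hio 0) (hi 0).ne ho.ne (hb b le_rfl), exists_eq_left, rel_inc]
    simp [h0]
  | get i =>
    intro ins o b hi ho hio
    refine ⟨copy (ins i) o b, fun σ hb h0 τ => ?_⟩
    rw [rel_copy (hio i) (hi i).ne ho.ne (hb b le_rfl)]
    simp [h0]
  -- The inner values go to `b, …, b + n - 1`, `f` is applied to them with scratch space from `b +
  -- n` on, and the block is cleared again.
  | @comp m n f g _ _ ihf ihg =>
    intro ins o b hi ho hio
    obtain ⟨p, hp⟩ := exists_computes_block g ihg ins b hi n le_rfl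
    obtain ⟨q, hq⟩ := ihf (fun i => b + i) o (b + n) (fun i => by lia) (by lia)
      (fun i => by lia)
    obtain ⟨c, hc⟩ := exists_rel_clear_block b n
    refine ⟨seq p (seq q c), fun σ hb h0 τ => ?_⟩
    simp only [rel_seq, hp σ hb, exists_eq_left]
    have h1 := hq (fun r => if h : b ≤ r ∧ r < b + n then
        g ⟨r - b, by lia⟩ (List.Vector.ofFn fun i => σ (ins i)) else σ r)
      (fun r hr => by rw [dif_neg (by lia)]; exact hb r (by lia))
      (by rw [dif_neg (by lia)]; exact h0)
    simp only [h1, hc, exists_eq_left]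
    refine Eq.congr_right ?_
    funext r
    simp only [Function.update_apply]
    rcases eq_or_ne r o with rfl | hr
    · rw [if_neg (by lia), if_pos rfl, if_pos rfl]
      congr
      funext i
      rw [dif_pos (by lia)]
      congr
      lia
    · rw [if_neg hr, if_neg hr]
      split_ifs with h
      · exact (hb r h.1).symm
      · rfl
  -- Register `b` holds the rounds left, `b + 1` the index of the round, `b + 2` the current value
  -- and `b + 3` the next value.
  | @prec n f g _ _ ihf ihg =>
    intro ins o b hi ho hio
    obtain ⟨p, hp⟩ := ihf (fun i => ins i.succ) (b + 2) (b + 4) (fun i => by have := hi i.succ; lia)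
      (by lia) (fun i => by have := hi i.succ; lia)
    obtain ⟨q, hq⟩ := ihg (Fin.cons (b + 1) (Fin.cons (b + 2) fun i => ins i.succ)) (b + 3) (b + 4)
      (by
        refine Fin.cases (by simp) (Fin.cases (by simp) fun i => ?_)
        have := hi i.succ
        simp only [Fin.cons_succ]
        lia)
      (by lia)
      (by
        refine Fin.cases (by simp) (Fin.cases (by simp) fun i => ?_)
        have := hi i.succ
        simp only [Fin.cons_succ]
        lia)
    let body := seq q (seq (clear (b + 2)) (seq (move (b + 3) (b + 2)) (single (inc (b + 1)))))
    refine ⟨seq (copy (ins 0) b (b + 3)) (seq p (seq (loop b body)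
      (seq (move (b + 2) o) (clear (b + 1))))), fun σ hb h0 τ => ?_⟩
    set N := σ (ins 0) with hN
    set v := List.Vector.ofFn fun i : Fin n => σ (ins i.succ) with hv
    let R : ℕ → ℕ := fun k => Nat.rec (f v) (fun y IH => g (y ::ᵥ IH ::ᵥ v)) k
    -- The loop invariant: the memory after `k` rounds of the recursion.
    let s : ℕ → ℕ → ℕ := fun k r =>
      if r = b then N - k else if r = b + 1 then k else if r = b + 2 then R k else σ r
    have hsins : ∀ k i, s k (ins i) = σ (ins i) := by
      intro k i
      have := hi i
      simp only [s]
      rw [if_neg (by lia), if_neg (by lia), if_neg (by lia)]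
    have hbody : ∀ k < N, ∀ τ,
        body.Rel (Function.update (s k) b (N - k - 1)) τ ↔ τ = s (k + 1) := by
      intro k hk τ
      have h1 := hq (Function.update (s k) b (N - k - 1))
        (fun r hr => by
          rw [Function.update_of_ne (by lia)]
          simp only [s]
          rw [if_neg (by lia), if_neg (by lia), if_neg (by lia)]
          exact hb r (by lia))
        (by
          rw [Function.update_of_ne (by lia)]
          simp only [s]
          rw [if_neg (by lia), if_neg (by lia), if_neg (by lia)]
          exact hb _ (by lia))
      have h2 : (List.Vector.ofFn fun i => Function.update (s k) b (N - k - 1)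
          ((Fin.cons (b + 1) (Fin.cons (b + 2) fun i => ins i.succ) : Fin (n + 2) → ℕ) i)) =
          k ::ᵥ R k ::ᵥ v := by
        simp only [List.Vector.ofFn, Fin.cons_zero, Fin.cons_succ]
        congr 1
        · simp [s]
        congr 1
        · simp [s]
        rw [hv]
        congr 1
        funext i
        have := hi i.succ
        rw [Function.update_of_ne (by lia), hsins]
      rw [h2] at h1
      simp only [body, rel_seq, h1, exists_eq_left, rel_clear, rel_inc,
        rel_move (show b + 3 ≠ b + 2 by lia)]
      refine Eq.congr_right ?_
      have h3 : R (k + 1) = g (k ::ᵥ R k ::ᵥ v) := rfl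
      have h4 := hb (b + 3) (by lia)
      funext r
      simp only [Function.update_apply, s, h3]
      split_ifs <;> lia
    have hloop := fun τ => rel_loop (p := body) (τ := τ) s (a := b) (n := N)
      (fun k _ => by simp [s]) hbody
    have h1 := hp (Function.update σ b N)
      (fun r hr => by rw [Function.update_of_ne (by lia)]; exact hb r (by lia))
      (by rw [Function.update_of_ne (by lia)]; exact hb _ (by lia))
    have h2 : (List.Vector.ofFn fun i : Fin n => Function.update σ b N (ins i.succ)) = v := by
      rw [hv]
      congr 1
      funext i
      have := hi i.succ
      rw [Function.update_of_ne (by lia)]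
    rw [h2] at h1
    have h3 : Function.update (Function.update σ b N) (b + 2) (f v) = s 0 := by
      have h4 := hb (b + 1) (by lia)
      funext r
      simp only [Function.update_apply, s]
      split_ifs <;> first | rfl | lia
    rw [h3] at h1
    have := hi 0
    simp only [rel_seq, rel_copy (show ins 0 ≠ b by lia) (show ins 0 ≠ b + 3 by lia)
      (show b ≠ b + 3 by lia) (hb (b + 3) (by lia)), exists_eq_left, hb b le_rfl, zero_add, ← hN,
      h1, hloop, rel_move (show b + 2 ≠ o by lia), rel_clear]
    refine Eq.congr_right ?_
    have h5 : R N = Nat.rec (f (List.Vector.ofFn fun i => σ (ins i)).tail)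
        (fun y IH => g (y ::ᵥ IH ::ᵥ (List.Vector.ofFn fun i => σ (ins i)).tail))
        (List.Vector.ofFn fun i => σ (ins i)).head := by
      simp only [List.Vector.head_ofFn, List.Vector.tail_ofFn]
      rfl
    rw [← h5]
    have h6 := hb b le_rfl
    have h7 := hb (b + 1) (by lia)
    have h8 := hb (b + 2) (by lia)
    funext r
    simp only [Function.update_apply, s]
    split_ifs <;> lia

/-! ### Undecidability of halting for counter programs -/

/-- The program can be executed with `n` in register `0` and zero in all other registers. -/
def HaltsOn (p : CounterProgram) (n : ℕ) : Prop := ∃ τ, p.Rel (Function.update (0 : ℕ → ℕ) 0 n) τ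

theorem rel_star_inc {r : ℕ} {σ τ : ℕ → ℕ} : (star (single (inc r))).Rel σ τ ↔
    ∃ k, τ = Function.update σ r (σ r + k) := by
  rw [rel_star]
  constructor
  · intro h
    induction h with
    | refl => exact ⟨0, by simp⟩
    | tail _ h ih =>
      obtain ⟨k, rfl⟩ := ih
      rw [rel_inc.1 h]
      exact ⟨k + 1, by simp [add_assoc]⟩
  · rintro ⟨k, rfl⟩
    induction k with
    | zero => simpa using Relation.ReflTransGen.refl
    | succ k ih => exact ih.tail (rel_inc.2 (by simp [add_assoc]))

/-- The program guesses `k` by repeated increments of register 1, computes `f n k` into register 2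
and tests it for zero. The guess replaces minimization, so primitive recursion suffices. -/
theorem exists_haltsOn_iff {f : ℕ → ℕ → ℕ} (hf : Primrec₂ f) :
    ∃ p : CounterProgram, ∀ n, p.HaltsOn n ↔ ∃ k, f n k = 0 := by
  obtain ⟨p, hp⟩ := exists_computes (Nat.Primrec'.prim_iff₂.2 hf) ![0, 1] 2 3
    (by simp [Fin.forall_fin_two]) (by simp) (by simp [Fin.forall_fin_two])
  refine ⟨seq (star (single (inc 1))) (seq p (single (zero 2))), fun n => ?_⟩
  simp only [HaltsOn, rel_seq, rel_star_inc, rel_zero]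
  have key : ∀ k τ, p.Rel (Function.update (Function.update (0 : ℕ → ℕ) 0 n) 1 k) τ ↔
      τ = Function.update (Function.update (Function.update (0 : ℕ → ℕ) 0 n) 1 k) 2 (f n k) := by
    intro k τ
    rw [hp _ (fun r hr => by
      rw [Function.update_of_ne (by lia), Function.update_of_ne (by lia)]; rfl) (by simp)]
    simp [List.Vector.ofFn]
  constructor
  · rintro ⟨_, _, ⟨k, rfl⟩, ρ, h1, h2, rfl⟩
    refine ⟨k, ?_⟩
    simp only [ne_eq, one_ne_zero, not_false_eq_true, Function.update_of_ne, Pi.zero_apply,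
      zero_add, key] at h1
    subst h1
    simpa using h2
  · rintro ⟨k, hk⟩
    refine ⟨_, _, ⟨k, rfl⟩, Function.update (Function.update (Function.update 0 0 n) 1 k) 2 (f n k),
      ?_, by simp [hk], rfl⟩
    simpa using (key k _).2 rfl

theorem exists_not_computablePred_haltsOn :
    ∃ p : CounterProgram, ¬ ComputablePred p.HaltsOn := by
  open Nat.Partrec in
  -- Zero exactly if the code numbered `n` halts on input 0 within the bound `k`.
  have hf : Primrec₂ fun n k : ℕ =>
      bif (Code.evaln k (Denumerable.ofNat Code n) 0).isSome then 0 else 1 :=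
    Primrec.cond (Primrec.option_isSome.comp (Code.primrec_evaln.comp
      ((Primrec.snd.pair ((Primrec.ofNat Code).comp Primrec.fst)).pair (Primrec.const 0))))
      (Primrec.const 0) (Primrec.const 1)
  obtain ⟨p, hp⟩ := exists_haltsOn_iff hf
  refine ⟨p, fun h => ComputablePred.halting_problem 0 ?_⟩
  obtain ⟨g, hg, hpg⟩ := ComputablePred.computable_iff.1 h
  refine ComputablePred.computable_iff.2 ⟨_, hg.comp Computable.encode, ?_⟩
  funext c
  have h1 := hp (Encodable.encode c)
  rw [hpg] at h1
  simp only [h1, Denumerable.ofNat_encode]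
  rw [Part.dom_iff_mem]
  simp only [Nat.Partrec.Code.evaln_complete]
  rw [exists_comm]
  refine propext (exists_congr fun k => ?_)
  cases h : Nat.Partrec.Code.evaln k c 0 <;> simp

end CounterProgram

/-! ### Automata with an arbitrary finite type of states -/

namespace LabeledAutomaton

/-- A labeled automaton whose states are numbered. -/
noncomputable def ofFintype {k : ℕ} {X Q : Type} [Fintype Q] (init accept : Finset Q)
    (delta : Q → Fin k → Q → Option X) : LabeledAutomaton k X where
  numStates := Fintype.card Q
  init := init.map (Fintype.equivFin Q).toEmbedding
  accept := accept.map (Fintype.equivFin Q).toEmbedding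
  delta q a q' := delta ((Fintype.equivFin Q).symm q) a ((Fintype.equivFin Q).symm q')

/-- `Trace δ q v x q'`: there is a path from `q` to `q'` that reads `v` and has total weight `x`. -/
inductive Trace {k : ℕ} {Q : Type} (δ : Q → Fin k → Q → Option ℤ) :
    Q → List (Fin k) → ℤ → Q → Prop
  | nil (q : Q) : Trace δ q [] 0 q
  | cons {q q' q'' : Q} {a : Fin k} {v : List (Fin k)} {x y : ℤ} :
      δ q a q' = some x → Trace δ q' v y q'' → Trace δ q (a :: v) (x + y) q''

variable {k : ℕ} {Q : Type}

theorem trace_cons_iff {δ : Q → Fin k → Q → Option ℤ} {q q'' : Q} {a : Fin k} {v : List (Fin k)}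
    {z : ℤ} : Trace δ q (a :: v) z q'' ↔
      ∃ q' x y, δ q a q' = some x ∧ Trace δ q' v y q'' ∧ z = x + y := by
  constructor
  · rintro (_ | ⟨h1, h2⟩)
    exact ⟨_, _, _, h1, h2, rfl⟩
  · rintro ⟨q', x, y, h1, h2, rfl⟩
    exact .cons h1 h2

theorem trace_nil_iff {δ : Q → Fin k → Q → Option ℤ} {q q' : Q} {z : ℤ} :
    Trace δ q [] z q' ↔ q' = q ∧ z = 0 := by
  constructor
  · rintro ⟨⟩
    exact ⟨rfl, rfl⟩
  · rintro ⟨rfl, rfl⟩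
    exact .nil _

theorem trace_of_states (δ : Q → Fin k → Q → Option ℤ) {n : ℕ} (u : Fin n → Fin k)
    (st : Fin (n + 1) → Q) (h : ∀ i : Fin n, (δ (st i.castSucc) (u i) (st i.succ)).isSome) :
    Trace δ (st 0) (List.ofFn u) (List.ofFn fun i => (δ _ _ _).get (h i)).sum
      (st (Fin.last n)) := by
  induction n with
  | zero => simpa using Trace.nil (δ := δ) (st 0)
  | succ n ih =>
    rw [List.ofFn_succ, List.ofFn_succ, List.sum_cons]
    exact .cons (Option.some_get (h 0)).symm
      (ih (fun i => u i.succ) (fun i => st i.succ) fun i => h i.succ)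

theorem Trace.exists_states {δ : Q → Fin k → Q → Option ℤ} {n : ℕ} {u : Fin n → Fin k}
    {q q' : Q} {x : ℤ} (h : Trace δ q (List.ofFn u) x q') :
    ∃ st : Fin (n + 1) → Q, st 0 = q ∧ st (Fin.last n) = q' ∧
      ∃ h : ∀ i : Fin n, (δ (st i.castSucc) (u i) (st i.succ)).isSome,
        (List.ofFn fun i => (δ _ _ _).get (h i)).sum = x := by
  induction n generalizing q x with
  | zero =>
    rw [List.ofFn_zero, trace_nil_iff] at h
    exact ⟨fun _ => q, rfl, h.1.symm, fun i => i.elim0, by simp [h.2]⟩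
  | succ n ih =>
    rw [List.ofFn_succ, trace_cons_iff] at h
    obtain ⟨p, y, z, h1, h2, rfl⟩ := h
    obtain ⟨st, h3, h4, h5, h6⟩ := ih h2
    have h0 : δ q (u 0) (st 0) = some y := by rw [h3, h1]
    refine ⟨Fin.cons q st, rfl, ?_, ?_, ?_⟩
    · rw [← Fin.succ_last, Fin.cons_succ, h4]
    · refine Fin.cases ?_ fun i => ?_
      · simp [h0]
      · simpa using h5 i
    · rw [List.ofFn_succ, List.sum_cons]
      congr 1
      simp [h0]

variable [Fintype Q] {init accept : Finset Q} {δ : Q → Fin k → Q → Option ℤ}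

theorem FinRun.trace {n : ℕ} {u : Fin n → Fin k} (r : (ofFintype init accept δ).FinRun u) :
    Trace δ ((Fintype.equivFin Q).symm (r.state 0)) (List.ofFn u) r.labels.sum
      ((Fintype.equivFin Q).symm (r.state (Fin.last n))) :=
  trace_of_states δ u (fun i => (Fintype.equivFin Q).symm (r.state i)) r.step

/-- Prefixes are needed because the width condition concerns all runs at all intermediate positions.
-/
theorem FinRun.exists_trace_take {n : ℕ} {u : Fin n → Fin k}
    (r : (ofFintype init accept δ).FinRun u) {t : ℕ} (ht : t ≤ n) :
    ∃ x, Trace δ ((Fintype.equivFin Q).symm (r.state 0))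
      (List.ofFn fun j : Fin t => u (j.castLE ht)) x
      ((Fintype.equivFin Q).symm (r.state ⟨t, by lia⟩)) :=
  ⟨_, trace_of_states δ (fun j : Fin t => u (j.castLE ht))
    (fun i => (Fintype.equivFin Q).symm (r.state (i.castLE (by lia))))
    fun i => r.step (i.castLE ht)⟩

theorem FinRun.state_zero_mem {n : ℕ} {u : Fin n → Fin k}
    (r : (ofFintype init accept δ).FinRun u) :
    (Fintype.equivFin Q).symm (r.state 0) ∈ init :=
  Finset.mem_map_equiv.1 r.state_zero

theorem exists_finRun {n : ℕ} {u : Fin n → Fin k} {q q' : Q} {x : ℤ}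
    (hq : q ∈ init) (hq' : q' ∈ accept) (h : Trace δ q (List.ofFn u) x q') :
    ∃ r : (ofFintype init accept δ).FinRun u, r.Accepting ∧ r.labels.sum = x := by
  obtain ⟨st, rfl, rfl, h1, rfl⟩ := h.exists_states
  refine ⟨⟨fun i => Fintype.equivFin Q (st i), ?_, ?_⟩, ?_, ?_⟩
  · exact Finset.mem_map_of_mem _ hq
  · intro i
    simpa [ofFintype] using h1 i
  · exact Finset.mem_map_of_mem _ hq'
  · simp only [FinRun.labels, ofFintype]
    congr 2
    funext i
    congr 1
    simp

end LabeledAutomaton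

open LabeledAutomaton

/-! ### Blocks: words over a large alphabet coded in binary -/

/-- The finite subword of `w` of length `l` at position `i`. -/
def subword {X : Type} (w : ℕ → X) (i l : ℕ) : List X := List.ofFn fun j : Fin l => w (i + j)

theorem subword_zero {X : Type} (w : ℕ → X) (i : ℕ) : subword w i 0 = [] := List.ofFn_zero

theorem subword_succ {X : Type} (w : ℕ → X) (i l : ℕ) :
    subword w i (l + 1) = w i :: subword w (i + 1) l := by
  simp only [subword, List.ofFn_succ, Fin.val_zero, add_zero, Fin.val_succ]
  congr 2
  funext j
  congr 1
  lia

theorem subword_add {X : Type} (w : ℕ → X) (i l m : ℕ) :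
    subword w i (l + m) = subword w i l ++ subword w (i + l) m := by
  induction l generalizing i with
  | zero => simp [subword_zero]
  | succ l ih =>
    rw [show l + 1 + m = (l + m) + 1 by lia, subword_succ, subword_succ, ih,
      show i + 1 + l = i + (l + 1) by lia]
    rfl

theorem subword_eq_iff {X : Type} (w : ℕ → X) (i : ℕ) (v : List X) :
    subword w i v.length = v ↔ ∀ j (h : j < v.length), w (i + j) = v[j] := by
  rw [List.ext_getElem_iff]
  simp [subword]

variable {M : ℕ}

/-- The binary code of a word over `Fin (M + 1)`: the letter `a` is coded as `1 ^ a 0`, and the end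
of the word as `1 ^ (M + 1)`. -/
def block : List (Fin (M + 1)) → List (Fin 2)
  | [] => List.replicate (M + 1) 1
  | a :: u => List.replicate a 1 ++ 0 :: block u

theorem replicate_append_zero_cons_inj {a b : ℕ} {x y : List (Fin 2)}
    (h : List.replicate a 1 ++ 0 :: x = List.replicate b 1 ++ 0 :: y) : a = b ∧ x = y := by
  induction a generalizing b with
  | zero =>
    cases b with
    | zero => simpa using h
    | succ b => simp [List.replicate_succ] at h
  | succ a ih =>
    cases b with
    | zero => simp [List.replicate_succ] at h
    | succ b =>
      simp only [List.replicate_succ, List.cons_append, List.cons.injEq, true_and] at h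
      obtain ⟨rfl, h'⟩ := ih h
      exact ⟨rfl, h'⟩

theorem replicate_append_ne {a b : ℕ} (hab : a < b) {x y : List (Fin 2)} :
    List.replicate a 1 ++ 0 :: x ≠ List.replicate b 1 ++ y := by
  induction a generalizing b with
  | zero =>
    obtain ⟨b, rfl⟩ := Nat.exists_eq_succ_of_ne_zero hab.ne'
    simp [List.replicate_succ]
  | succ a ih =>
    obtain ⟨b, rfl⟩ := Nat.exists_eq_succ_of_ne_zero (Nat.ne_zero_of_lt hab)
    simpa [List.replicate_succ] using ih (Nat.lt_of_succ_lt_succ hab)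

/-- The code is prefix-free: a letter contributes at most `M` ones before its `0`, which is fewer
than the end marker has. -/
theorem block_append_inj {u u' : List (Fin (M + 1))} {z z' : List (Fin 2)}
    (h : block u ++ z = block u' ++ z') : u = u' := by
  induction u generalizing u' with
  | nil =>
    cases u' with
    | nil => rfl
    | cons a u' =>
      simp only [block, List.append_assoc, List.cons_append] at h
      exact absurd h.symm (replicate_append_ne a.isLt)
  | cons a u ih =>
    cases u' with
    | nil =>
      simp only [block, List.append_assoc, List.cons_append] at h
      exact absurd h (replicate_append_ne a.isLt)
    | cons b u' =>
      simp only [block, List.append_assoc, List.cons_append] at h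
      obtain ⟨h1, h2⟩ := replicate_append_zero_cons_inj h
      rw [Fin.ext h1, ih h2]

/-! ### The decoder and the positions where blocks begin -/

/-- The number of letters `1` that have been read since the last letter was decoded; `none` marks
the beginning of a block. -/
def ones : Option (Fin (M + 1)) → ℕ
  | none => 0
  | some j => j

/-- The transition function of the decoder. -/
def next (p : Option (Fin (M + 1))) (b : Fin 2) : Option (Fin (M + 1)) :=
  if b = 0 then some 0 else if h : ones p + 1 < M + 1 then some ⟨ones p + 1, h⟩ else none

variable (M) in
/-- The state of the decoder before position `i`. -/
def parse (w : ℕ → Fin 2) : ℕ → Option (Fin (M + 1))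
  | 0 => none
  | i + 1 => next (parse w i) (w i)

theorem ones_le (p : Option (Fin (M + 1))) : ones p ≤ M := by
  cases p with
  | none => exact Nat.zero_le M
  | some j => exact Nat.le_of_lt_succ j.isLt

theorem parse_succ_of_zero {w : ℕ → Fin 2} {i : ℕ} (h : w i = 0) : parse M w (i + 1) = some 0 := by
  simp [parse, next, h]

theorem parse_succ_of_one {w : ℕ → Fin 2} {i : ℕ} (h : w i = 1)
    (h' : ones (parse M w i) + 1 < M + 1) :
    parse M w (i + 1) = some ⟨ones (parse M w i) + 1, h'⟩ := by
  simp [parse, next, h, h']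

theorem parse_succ_of_one_of_eq {w : ℕ → Fin 2} {i : ℕ} (h : w i = 1)
    (h' : ones (parse M w i) = M) : parse M w (i + 1) = none := by
  simp [parse, next, h, h']

theorem fin_two_cases (b : Fin 2) : b = 0 ∨ b = 1 := by lia

/-- For the induction the segment may start in the middle of a coded letter; the ones already read
are put back in front. -/
theorem exists_block_of_parse {w : ℕ → Fin 2} {i l : ℕ} (hl : 0 < l)
    (h0 : parse M w (i + l) = none) (h : ∀ t, 0 < t → t < l → parse M w (i + t) ≠ none) :
    ∃ u : List (Fin (M + 1)),
      List.replicate (ones (parse M w i)) 1 ++ subword w i l = block u := by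
  induction l generalizing i with
  | zero => lia
  | succ l ih =>
    rw [subword_succ]
    rcases Nat.eq_zero_or_pos l with rfl | hl'
    · rcases fin_two_cases (w i) with hw | hw
      · rw [zero_add, parse_succ_of_zero hw] at h0
        simp at h0
      · by_cases h' : ones (parse M w i) + 1 < M + 1
        · rw [zero_add, parse_succ_of_one hw h'] at h0
          simp at h0
        · refine ⟨[], ?_⟩
          have := ones_le (parse M w i)
          rw [subword_zero, hw, ← List.replicate_succ', block]
          congr 1
          lia
    · obtain ⟨u, hu⟩ := ih hl' (i := i + 1) (by rw [← h0]; congr 1; lia)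
        (fun t ht htl => by
          rw [show i + 1 + t = i + (t + 1) by lia]
          exact h (t + 1) (by lia) (by lia))
      rcases fin_two_cases (w i) with hw | hw
      · rw [parse_succ_of_zero hw] at hu
        refine ⟨⟨ones (parse M w i), Nat.lt_succ_of_le (ones_le _)⟩ :: u, ?_⟩
        rw [block, ← hu, hw]
        rfl
      · by_cases h' : ones (parse M w i) + 1 < M + 1
        · rw [parse_succ_of_one hw h'] at hu
          refine ⟨u, ?_⟩
          rw [← hu, hw]
          simp [ones, List.replicate_succ']
        · have := ones_le (parse M w i)
          exact absurd (parse_succ_of_one_of_eq hw (by lia)) (h 1 one_pos (by lia))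

theorem ones_parse_add {w : ℕ → Fin 2} {i t : ℕ} (h : ∀ j < t, w (i + j) = 1)
    (h' : ones (parse M w i) + t ≤ M) : ones (parse M w (i + t)) = ones (parse M w i) + t := by
  induction t with
  | zero => rfl
  | succ t ih =>
    have ih := ih (fun j hj => h j (by lia)) (by lia)
    rw [← add_assoc, parse_succ_of_one (h t (by lia)) (by lia)]
    change ones (parse M w (i + t)) + 1 = _
    lia

/-- The pattern `0 1 ^ (M + 1)` marks the end of a block. -/
theorem parse_eq_none_of_subword {w : ℕ → Fin 2} {i : ℕ} {v : List (Fin 2)}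
    (h : subword w i (0 :: (List.replicate (M + 1) 1 ++ v)).length =
      0 :: (List.replicate (M + 1) 1 ++ v)) :
    parse M w (i + (M + 2)) = none ∧ subword w (i + (M + 2)) v.length = v := by
  rw [show (0 :: (List.replicate (M + 1) 1 ++ v)).length = ((M + 1) + v.length) + 1 by simp,
    subword_succ, subword_add, List.cons.injEq] at h
  obtain ⟨h0, h⟩ := h
  obtain ⟨h1, h2⟩ := List.append_inj h (by simp [subword])
  rw [show i + 1 + (M + 1) = i + (M + 2) by lia] at h2
  refine ⟨?_, h2⟩
  have h3 : ∀ j < M + 1, w (i + 1 + j) = 1 := by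
    have := (subword_eq_iff w (i + 1) (List.replicate (M + 1) 1)).1 (by simpa using h1)
    intro j hj
    rw [this j (by simpa using hj), List.getElem_replicate]
  -- The leading `0` resets the counter whatever the decoder has seen before. Then `M` ones raise it
  -- to `M`, and one more closes the block.
  have h4 : ones (parse M w (i + 1)) = 0 := by
    rw [parse_succ_of_zero h0]
    rfl
  have h5 := ones_parse_add (fun j hj => h3 j (by lia))
    (show ones (parse M w (i + 1)) + M ≤ M by lia)
  have h6 := parse_succ_of_one_of_eq (M := M) (h3 M (by lia)) (by lia)
  rwa [show i + 1 + M + 1 = i + (M + 2) by lia] at h6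

/-! ### Weighted automata on blocks -/

section

variable {T : Type}

/-- `WordWeight δ fin s u x`: some path that reads `u` from `s` has total weight `x`, including the
weight of its last state. -/
def WordWeight {A : Type} (δ : T → A → T → Option ℤ) (fin : T → Option ℤ) :
    T → List A → ℤ → Prop
  | s, [], x => fin s = some x
  | s, a :: u, x => ∃ s' y z, δ s a s' = some y ∧ WordWeight δ fin s' u z ∧ x = y + z

open Classical in
/-- The automaton that simulates `δ` on blocks. The state `none` is reached at the end of the
block. -/
noncomputable def blockDelta (δ : T → Fin (M + 1) → T → Option ℤ) (fin : T → Option ℤ) :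
    Option (T × Fin (M + 1)) → Fin 2 → Option (T × Fin (M + 1)) → Option ℤ
  | none, _, _ => none
  | some (s, j), b, none => if b = 1 ∧ j.val = M then fin s else none
  | some (s, j), b, some (s', j') =>
    if b = 0 then if j' = 0 then δ s j s' else none
    else if s = s' ∧ j'.val = j.val + 1 then some 0 else none

variable {δ : T → Fin (M + 1) → T → Option ℤ} {fin : T → Option ℤ}

theorem blockDelta_zero {s s' : T} {j j' : Fin (M + 1)} {x : ℤ} :
    blockDelta δ fin (some (s, j)) 0 (some (s', j')) = some x ↔ j' = 0 ∧ δ s j s' = some x := by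
  simp only [blockDelta]
  split_ifs <;> simp_all

theorem blockDelta_one {s s' : T} {j j' : Fin (M + 1)} {x : ℤ} :
    blockDelta δ fin (some (s, j)) 1 (some (s', j')) = some x ↔
      s = s' ∧ j'.val = j.val + 1 ∧ x = 0 := by
  simp only [blockDelta]
  split_ifs <;> simp_all [eq_comm]

theorem blockDelta_none {s : T} {j : Fin (M + 1)} {b : Fin 2} {x : ℤ} :
    blockDelta δ fin (some (s, j)) b none = some x ↔ b = 1 ∧ j.val = M ∧ fin s = some x := by
  simp only [blockDelta]
  split_ifs <;> simp_all

/-- No transition leaves `none`, which forces a slave to stop at the end of its block. -/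
theorem trace_none_iff {v : List (Fin 2)} {x : ℤ} {q : Option (T × Fin (M + 1))} :
    Trace (blockDelta δ fin) none v x q ↔ v = [] ∧ x = 0 ∧ q = none := by
  cases v with
  | nil => simp [trace_nil_iff, and_comm]
  | cons b v =>
    rw [trace_cons_iff]
    simp [blockDelta]

theorem exists_wordWeight_of_trace {s : T} {j : Fin (M + 1)} {v : List (Fin 2)} {x : ℤ}
    (h : Trace (blockDelta δ fin) (some (s, j)) v x none) :
    ∃ u, List.replicate j 1 ++ v = block u ∧ WordWeight δ fin s u x := by
  induction v generalizing s j x with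
  | nil => simp [trace_nil_iff] at h
  | cons b v ih =>
    obtain ⟨q, y, z, h1, h2, rfl⟩ := trace_cons_iff.1 h
    rcases q with _ | ⟨s', j'⟩
    · obtain ⟨rfl, hj, hs⟩ := blockDelta_none.1 h1
      obtain ⟨rfl, rfl, -⟩ := trace_none_iff.1 h2
      refine ⟨[], ?_, by simpa [WordWeight] using hs⟩
      rw [← List.replicate_succ', hj]
      rfl
    · obtain ⟨u, hu, hw⟩ := ih h2
      rcases fin_two_cases b with rfl | rfl
      · obtain ⟨rfl, hs⟩ := blockDelta_zero.1 h1
        exact ⟨j :: u, by rw [block, ← hu]; rfl, s', y, z, hs, hw, rfl⟩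
      · obtain ⟨rfl, hj, rfl⟩ := blockDelta_one.1 h1
        refine ⟨u, ?_, by simpa using hw⟩
        rw [← hu, hj, List.replicate_succ']
        simp

theorem trace_replicate_append {s : T} {j j' : Fin (M + 1)} {k : ℕ} (h : j.val + k = j'.val)
    {v : List (Fin 2)} {x : ℤ} {q : Option (T × Fin (M + 1))}
    (ht : Trace (blockDelta δ fin) (some (s, j')) v x q) :
    Trace (blockDelta δ fin) (some (s, j)) (List.replicate k 1 ++ v) x q := by
  induction k generalizing j with
  | zero =>
    obtain rfl : j = j' := Fin.ext h
    exact ht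
  | succ k ih =>
    rw [List.replicate_succ, List.cons_append, ← zero_add x]
    exact .cons (blockDelta_one.2 ⟨rfl, rfl, rfl⟩)
      (ih (j := ⟨j.val + 1, by lia⟩) (by simp only; lia))

theorem trace_block {s : T} {u : List (Fin (M + 1))} {x : ℤ} (h : WordWeight δ fin s u x) :
    Trace (blockDelta δ fin) (some (s, 0)) (block u) x none := by
  induction u generalizing s x with
  | nil =>
    rw [block, List.replicate_succ']
    refine trace_replicate_append (j' := Fin.last M) (by simp) ?_
    rw [← add_zero x]
    exact .cons (blockDelta_none.2 ⟨rfl, rfl, h⟩) (.nil _)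
  | cons a u ih =>
    obtain ⟨s', y, z, h1, h2, rfl⟩ := h
    exact trace_replicate_append (j' := a) (by simp)
      (.cons (blockDelta_zero.2 ⟨rfl, h1⟩) (ih h2))

/-- The slave keeps the same count of ones as the decoder. At `t = 0` the two may differ, since the
decoder is in `none` where the slave starts with count 0. -/
theorem parse_of_trace {w : ℕ → Fin 2} {i t : ℕ} {s s' : T} {j j' : Fin (M + 1)} {x : ℤ}
    (h : Trace (blockDelta δ fin) (some (s, j)) (subword w i t) x (some (s', j')))
    (hj : ones (parse M w i) = j) (ht : 0 < t) : parse M w (i + t) = some j' := by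
  induction t generalizing i s j x with
  | zero => lia
  | succ t ih =>
    rw [subword_succ] at h
    obtain ⟨q, y, z, h1, h2, rfl⟩ := trace_cons_iff.1 h
    rcases q with _ | ⟨s₁, j₁⟩
    · simpa using (trace_none_iff.1 h2).2.2
    have hp : parse M w (i + 1) = some j₁ := by
      rcases fin_two_cases (w i) with hw | hw
      · rw [hw] at h1
        rw [parse_succ_of_zero hw, (blockDelta_zero.1 h1).1]
      · rw [hw] at h1
        obtain ⟨-, hj₁, -⟩ := blockDelta_one.1 h1
        rw [parse_succ_of_one hw (by lia)]
        congr 1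
        ext
        simp only
        lia
    rcases Nat.eq_zero_or_pos t with rfl | ht'
    · rw [subword_zero, trace_nil_iff] at h2
      obtain ⟨h2, -⟩ := h2
      simp only [Option.some.injEq, Prod.mk.injEq] at h2
      rw [zero_add, hp, h2.2]
    · rw [← ih h2 (by rw [hp]; rfl) ht']
      congr 1
      lia

end

/-! ### The nested automaton that invokes a slave at the beginning of every block -/

section

variable {M : ℕ} {T : Type} [Fintype T]

/-- The slave that accepts only the empty word. -/
def silentSlave : LabeledAutomaton 2 ℤ where
  numStates := 1
  init := {0}
  accept := {0}
  delta _ _ _ := none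

/-- The slave that simulates a weighted automaton on a block. -/
noncomputable def blockSlave (init : Finset T) (δ : T → Fin (M + 1) → T → Option ℤ)
    (fin : T → Option ℤ) : LabeledAutomaton 2 ℤ :=
  ofFintype (Q := Option (T × Fin (M + 1)))
    (init.map ((Function.Embedding.sectL T (0 : Fin (M + 1))).trans Function.Embedding.some)) {none}
    (blockDelta δ fin)

def masterDelta (p : Option (Fin (M + 1))) (b : Fin 2) (p' : Option (Fin (M + 1))) :
    Option (Fin 2) :=
  if p' = next p b then some (if p = none then 1 else 0) else none

theorem masterDelta_eq_some {p p' : Option (Fin (M + 1))} {b ℓ : Fin 2} :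
    masterDelta p b p' = some ℓ ↔ p' = next p b ∧ ℓ = if p = none then 1 else 0 := by
  unfold masterDelta
  by_cases h : p' = next p b
  · simp [h, eq_comm]
  · simp [h]

variable (M) in
/-- The master, which decodes the word and invokes slave `1` at the beginning of every block and
the silent slave `0` elsewhere. -/
noncomputable def blockMaster : LabeledAutomaton 2 (Fin 2) :=
  ofFintype (Q := Option (Fin (M + 1))) {none} {none} masterDelta

noncomputable def blockNWA (init : Finset T) (δ : T → Fin (M + 1) → T → Option ℤ)
    (fin : T → Option ℤ) : NWA 2 where
  numSlaves := 2
  master := blockMaster M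
  slave ℓ := if ℓ = 0 then silentSlave else blockSlave init δ fin

variable {w : ℕ → Fin 2}

theorem blockMaster_step (r : (blockMaster M).InfRun w) (i : ℕ) :
    masterDelta ((Fintype.equivFin (Option (Fin (M + 1)))).symm (r.state i)) (w i)
      ((Fintype.equivFin (Option (Fin (M + 1)))).symm (r.state (i + 1))) = some (r.label i) :=
  (Option.some_get (r.step i)).symm

theorem blockMaster_state (r : (blockMaster M).InfRun w) (i : ℕ) :
    (Fintype.equivFin (Option (Fin (M + 1)))).symm (r.state i) = parse M w i := by
  induction i with
  | zero => exact Finset.mem_singleton.1 (Finset.mem_map_equiv.1 r.state_zero)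
  | succ i ih => rw [parse, ← ih, (masterDelta_eq_some.1 (blockMaster_step r i)).1]

theorem blockMaster_label (r : (blockMaster M).InfRun w) (i : ℕ) :
    r.label i = (if parse M w i = none then 1 else 0 : Fin 2) := by
  rw [← blockMaster_state r i]
  exact (masterDelta_eq_some.1 (blockMaster_step r i)).2

theorem exists_blockMaster_run (w : ℕ → Fin 2) (h : ∃ᶠ i in atTop, parse M w i = none) :
    ∃ r : (blockMaster M).InfRun w, r.Accepting := by
  refine ⟨⟨fun i => Fintype.equivFin (Option (Fin (M + 1))) (parse M w i), ?_, ?_⟩, ?_⟩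
  · exact Finset.mem_map_of_mem _ (Finset.mem_singleton_self none)
  · intro i
    simp [blockMaster, ofFintype, parse, masterDelta]
  · exact ⟨_, Finset.mem_map_of_mem _ (Finset.mem_singleton_self none),
      h.mono fun i hi => congrArg _ hi⟩

variable {init : Finset T} {δ : T → Fin (M + 1) → T → Option ℤ} {fin : T → Option ℤ}

theorem len_eq_zero_of_silent {n : ℕ} {u : Fin n → Fin 2} {ℓ : Fin 2} (hℓ : ℓ = 0)
    (r : ((blockNWA init δ fin).slave ℓ).FinRun u) : n = 0 := by
  subst hℓ
  rcases Nat.eq_zero_or_pos n with h | h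
  · exact h
  · have := r.step ⟨0, h⟩
    simp [blockNWA, silentSlave] at this

theorem exists_silent_run {n : ℕ} (u : Fin n → Fin 2) {ℓ : Fin 2} (hℓ : ℓ = 0) (hn : n = 0) :
    ∃ r : ((blockNWA init δ fin).slave ℓ).FinRun u, r.Accepting := by
  subst hℓ hn
  exact ⟨⟨fun _ => (0 : Fin 1), Finset.mem_singleton_self (0 : Fin 1), fun i => i.elim0⟩,
    Finset.mem_singleton_self (0 : Fin 1)⟩

theorem exists_trace_of_accepting {n : ℕ} {u : Fin n → Fin 2} {ℓ : Fin 2} (hℓ : ℓ = 1)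
    (r : ((blockNWA init δ fin).slave ℓ).FinRun u) (hr : r.Accepting) :
    ∃ s ∈ init, Trace (blockDelta δ fin) (some (s, 0)) (List.ofFn u) r.labels.sum none := by
  subst hℓ
  change (blockSlave init δ fin).FinRun u at r
  have h := FinRun.trace r
  obtain ⟨s, hs, hs'⟩ := Finset.mem_map.1 (FinRun.state_zero_mem r)
  have h2 := Finset.mem_singleton.1 (Finset.mem_map_equiv.1 hr)
  rw [← hs'] at h
  exact ⟨s, hs, (congrArg (Trace (blockDelta δ fin) (some (s, 0)) (List.ofFn u) r.labels.sum)
    h2).mp h⟩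

theorem exists_active_run {n : ℕ} {u : Fin n → Fin 2} {ℓ : Fin 2} (hℓ : ℓ = 1) {s : T}
    (hs : s ∈ init) {x : ℤ}
    (h : Trace (blockDelta δ fin) (some (s, 0)) (List.ofFn u) x none) :
    ∃ r : ((blockNWA init δ fin).slave ℓ).FinRun u, r.Accepting ∧ r.labels.sum = x := by
  subst hℓ
  exact exists_finRun (Finset.mem_map.2 ⟨s, hs, rfl⟩) (Finset.mem_singleton_self _) h

/-- A slave that still has a letter to read is not in its dead end `none`, so the decoder is
strictly inside the block. Acceptance is not assumed, as width is a condition on all runs. -/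
theorem parse_ne_none_of_active {i t n : ℕ} {ℓ : Fin 2} (hℓ : ℓ = 1) (hi : parse M w i = none)
    (r : ((blockNWA init δ fin).slave ℓ).FinRun (fun j : Fin n => w (i + j))) (ht : 0 < t)
    (htn : t < n) : parse M w (i + t) ≠ none := by
  subst hℓ
  change (blockSlave init δ fin).FinRun _ at r
  obtain ⟨x, hx⟩ := FinRun.exists_trace_take r htn.le
  obtain ⟨s, hs, hs'⟩ := Finset.mem_map.1 (FinRun.state_zero_mem r)
  rw [← hs'] at hx
  have h : (blockDelta δ fin ((Fintype.equivFin (Option (T × Fin (M + 1)))).symm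
    (r.state ⟨t, by lia⟩)) (w (i + t)) ((Fintype.equivFin (Option (T × Fin (M + 1)))).symm
    (r.state ⟨t + 1, by lia⟩))).isSome := r.step ⟨t, htn⟩
  generalize (Fintype.equivFin (Option (T × Fin (M + 1)))).symm (r.state ⟨t, by lia⟩) = q at hx h
  rcases q with _ | ⟨s', j'⟩
  · simp [blockDelta] at h
  · rw [parse_of_trace hx (by rw [hi]; rfl) ht]
    simp

/-- Active slaves start at beginnings of blocks. If two were active at once, the later one would
start strictly inside the block of the earlier one. -/
theorem hasWidth_blockNWA (init : Finset T) (δ : T → Fin (M + 1) → T → Option ℤ)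
    (fin : T → Option ℤ) : (blockNWA init δ fin).HasWidth 1 := by
  intro w r p
  have hl : ∀ i, r.ActiveAt i p → parse M w i = none ∧ r.master.label i = (1 : Fin 2) := by
    intro i hi
    have h1 := blockMaster_label r.master i
    by_cases h : parse M w i = none
    · rw [if_pos h] at h1
      exact ⟨h, h1⟩
    · rw [if_neg h] at h1
      have := len_eq_zero_of_silent h1 (r.slave i)
      have := hi.1
      have := hi.2
      lia
  have key : ∀ i i', r.ActiveAt i p → r.ActiveAt i' p → ¬ i < i' := by
    intro i i' hi hi' hlt
    obtain ⟨h1, h2⟩ := hl i hi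
    have := hi.2
    have := hi'.1
    have h3 := parse_ne_none_of_active h2 h1 (r.slave i) (t := i' - i) (by lia) (by lia)
    rw [show i + (i' - i) = i' by lia] at h3
    exact h3 (hl i' hi').1
  rw [Set.ncard_le_one ((Set.finite_Iic p).subset fun i hi => hi.1)]
  intro i hi i' hi'
  exact le_antisymm (not_lt.1 (key i' i hi' hi)) (not_lt.1 (key i i' hi hi'))

/-! ### Limits of sequences without silent entries -/

theorem limSupValue_removeSilent_le {v : ℕ → Option ℤ} (h : ∃ᶠ i in atTop, (v i).isSome)
    {c : ℤ} (hc : ∀ i, ∀ x ∈ v i, x ≤ c) :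
    limSupValue (removeSilent v) ≤ ((c : ℝ) : EReal) := by
  refine limsup_le_of_le (by isBoundedDefault) (Eventually.of_forall fun n => ?_)
  -- There are infinitely many non-silent entries, so `Nat.nth` never falls back to its default
  -- value 0.
  have h1 : (v (Nat.nth (fun i => (v i).isSome) n)).isSome :=
    Nat.nth_mem_of_infinite (p := fun i => (v i).isSome) (Nat.frequently_atTop_iff_infinite.1 h) n
  obtain ⟨x, hx⟩ := Option.isSome_iff_exists.1 h1
  rw [removeSilent, hx]
  exact_mod_cast hc _ x hx

theorem le_limSupValue_removeSilent {v : ℕ → Option ℤ} {c : ℤ}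
    (hc : ∃ᶠ i in atTop, ∃ x ∈ v i, c ≤ x) :
    ((c : ℝ) : EReal) ≤ limSupValue (removeSilent v) := by
  refine le_limsup_of_frequently_le' (frequently_atTop.2 fun a => ?_)
  have hinf : (Set.ofPred fun i => ((v i).isSome : Prop)).Infinite :=
    Nat.frequently_atTop_iff_infinite.1
      (hc.mono fun i ⟨x, hx, _⟩ => Option.isSome_iff_exists.2 ⟨x, hx⟩)
  obtain ⟨i, hi, x, hx, hcx⟩ := frequently_atTop.1 hc (Nat.nth (fun i => (v i).isSome) a)
  have hx' : (v i).isSome := by simp [Option.mem_def.1 hx]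
  refine ⟨Nat.count (fun i => (v i).isSome) i, ?_, ?_⟩
  · rw [← Nat.count_nth_of_infinite hinf a]
    exact Nat.count_monotone _ hi
  · rw [removeSilent, Nat.nth_count (p := fun i => (v i).isSome) hx', Option.mem_def.1 hx]
    exact_mod_cast hcx

/-! ### The value of a word -/

/-- Slaves do not interact, so a cheap path can be chosen for each block separately. -/
theorem exists_accepting_run (hw : ∃ᶠ i in atTop, parse M w i = none) {c : ℤ}
    (hc : ∀ u, ∃ s ∈ init, ∃ x ≤ c, WordWeight δ fin s u x) :
    ∃ r : (blockNWA init δ fin).Run w, r.Accepting ∧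
      r.value limSupValue sumValue ≤ ((c : ℝ) : EReal) := by
  obtain ⟨m, hm⟩ := exists_blockMaster_run w hw
  have key : ∀ i, ∃ (l : ℕ) (r : ((blockNWA init δ fin).slave (m.label i)).FinRun
      (fun j : Fin l => w (i + j))), r.Accepting ∧
      (0 < l → r.labels.sum ≤ c) ∧ (parse M w i = none → 0 < l) := by
    intro i
    have hl := blockMaster_label m i
    by_cases h : parse M w i = none
    · rw [if_pos h] at hl
      have hex : ∃ t, 0 < t ∧ parse M w (i + t) = none := by
        obtain ⟨e, he, he'⟩ := frequently_atTop.1 hw (i + 1)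
        exact ⟨e - i, by lia, by rwa [show i + (e - i) = e by lia]⟩
      -- `Nat.find hex` is the distance to the next end of a block, which is the length of the slave
      -- run.
      classical
      obtain ⟨h1, h2⟩ := Nat.find_spec hex
      obtain ⟨u, hu⟩ := exists_block_of_parse h1 h2
        (fun t ht ht' h' => Nat.find_min hex ht' ⟨ht, h'⟩)
      rw [h] at hu
      obtain ⟨s, hs, x, hx, hux⟩ := hc u
      have ht := trace_block hux
      rw [← hu] at ht
      obtain ⟨r, hr, rfl⟩ := exists_active_run hl hs ht
      exact ⟨Nat.find hex, r, hr, fun _ => hx, fun _ => h1⟩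
    · rw [if_neg h] at hl
      obtain ⟨r, hr⟩ := exists_silent_run (init := init) (δ := δ) (fin := fin)
        (fun j : Fin 0 => w (i + j)) hl rfl
      exact ⟨0, r, hr, by simp, fun h' => absurd h' h⟩
  choose len slave hacc hle hpos using key
  have hfreq : ∃ᶠ i in atTop, 0 < len i := hw.mono hpos
  refine ⟨⟨m, len, slave⟩, ⟨hm, hacc, hfreq⟩, limSupValue_removeSilent_le ?_ ?_⟩
  · refine hfreq.mono fun i hi => ?_
    simp [FinRun.value, hi.ne']
  · intro i x hx
    simp only [FinRun.value] at hx
    split_ifs at hx with h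
    · simp at hx
    · rw [← Option.some.inj hx]
      exact hle i (Nat.pos_of_ne_zero h)

theorem accepts_blockNWA (hw : ∃ᶠ i in atTop, parse M w i = none) {c : ℤ}
    (hc : ∀ u, ∃ s ∈ init, ∃ x ≤ c, WordWeight δ fin s u x) :
    (blockNWA init δ fin).Accepts w :=
  let ⟨r, hr, _⟩ := exists_accepting_run hw hc
  ⟨r, hr⟩

theorem limSupSumValue_blockNWA_le (hw : ∃ᶠ i in atTop, parse M w i = none) {c : ℤ}
    (hc : ∀ u, ∃ s ∈ init, ∃ x ≤ c, WordWeight δ fin s u x) :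
    (blockNWA init δ fin).limSupSumValue w ≤ ((c : ℝ) : EReal) :=
  let ⟨r, hr, hr'⟩ := exists_accepting_run hw hc
  iInf₂_le_of_le r hr hr'

/-- One block that is expensive for every path and recurs forever bounds the limit superior from
below, whatever the run does elsewhere. -/
theorem le_limSupSumValue_blockNWA {u : List (Fin (M + 1))} {c : ℤ}
    (hw : ∃ᶠ i in atTop, parse M w i = none ∧ subword w i (block u).length = block u)
    (hc : ∀ s ∈ init, ∀ x, WordWeight δ fin s u x → c ≤ x) :
    ((c : ℝ) : EReal) ≤ (blockNWA init δ fin).limSupSumValue w := by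
  refine le_iInf₂ fun r hr => le_limSupValue_removeSilent (hw.mono fun i hi => ?_)
  have hl := blockMaster_label r.master i
  rw [if_pos hi.1] at hl
  obtain ⟨s, hs, ht⟩ := exists_trace_of_accepting hl (r.slave i) (hr.2.1 i)
  obtain ⟨u', hu', hx⟩ := exists_wordWeight_of_trace ht
  change [] ++ subword w i (r.len i) = block u' at hu'
  rw [List.nil_append] at hu'
  have hpos : r.len i ≠ 0 := by
    intro h
    rw [h, subword_zero] at hu'
    cases u' <;> simp [block] at hu'
  -- The word read by the slave and `block u` are both codes that are prefixes of the same subword,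
  -- so they agree.
  obtain rfl : u' = u := by
    refine block_append_inj (z := subword w (i + r.len i) (block u).length)
      (z' := subword w (i + (block u).length) (r.len i)) ?_
    nth_rw 2 [← hi.2]
    rw [← hu', ← subword_add, ← subword_add, add_comm]
  exact ⟨_, if_neg hpos, hc s hs _ hx⟩

end

/-! ### The weighted automaton that searches for an error in a run of a counter program -/

namespace Check

/-- The weight of reading `a` while waiting for an illegal occurrence of `c`. -/
def drift : CounterOp → CounterOp → ℤ
  | dec r, inc r' => if r = r' then 1 else 0
  | dec r, dec r' => if r = r' then -1 else 0
  | zero r, inc r' => if r = r' then -1 else 0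
  | zero r, dec r' => if r = r' then 1 else 0
  | _, _ => 0

/-- The weight of an occurrence of an instruction that is claimed to be illegal, if the run starts
in `σ₀`. -/
def exitWeight (σ₀ : ℕ → ℕ) : CounterOp → Option ℤ
  | inc _ => none
  | dec r => some (σ₀ r - 1)
  | zero r => some (-σ₀ r)

/-- Minus the weight collected by a watcher of the given instruction on the way from `σ₀` to
`σ`. -/
def offset (σ₀ σ : ℕ → ℕ) : CounterOp → ℤ
  | inc _ => 0
  | dec r => σ₀ r - σ r
  | zero r => σ r - σ₀ r

theorem offset_self (σ₀ : ℕ → ℕ) (a : CounterOp) : offset σ₀ σ₀ a = 0 := by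
  cases a <;> simp [offset]

/-- A potential argument: along legal steps the drifts telescope. A watcher that leaves at memory
`σ` has total weight `σ r - 1` for `dec r` and `-σ r` for `zero r`. -/
theorem offset_eq_drift_add {σ₀ σ τ : ℕ → ℕ} {a : CounterOp} (h : step a σ = some τ)
    (c : CounterOp) : offset σ₀ σ c = drift c a + offset σ₀ τ c := by
  cases a with
  | inc r =>
    obtain rfl := Option.some.inj h
    cases c <;> simp only [offset, drift, Function.update_apply] <;>
      (try split_ifs) <;> simp_all <;> lia
  | dec r =>
    simp only [step] at h
    split_ifs at h with h'
    obtain rfl := Option.some.inj h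
    cases c <;> simp only [offset, drift, Function.update_apply] <;>
      (try split_ifs) <;> simp_all <;> lia
  | zero r =>
    simp only [step] at h
    split_ifs at h with h'
    obtain rfl := Option.some.inj h
    cases c <;> simp [offset, drift]

theorem offset_le_exitWeight {σ₀ σ τ : ℕ → ℕ} {a : CounterOp} (h : step a σ = some τ) {y : ℤ}
    (hy : exitWeight σ₀ a = some y) : offset σ₀ σ a ≤ y := by
  cases a <;> simp only [step, exitWeight, offset, Option.some.injEq, reduceCtorEq] at h hy ⊢
  all_goals
    split_ifs at h with h'
    lia

/-- An illegal decrement meets `σ r = 0` and an illegal zero test meets `σ r ≥ 1`; in both cases the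
total is at most -1. Increments are never illegal. -/
theorem exists_exitWeight_le {σ₀ σ : ℕ → ℕ} {a : CounterOp} (h : step a σ = none) :
    ∃ y, exitWeight σ₀ a = some y ∧ y ≤ offset σ₀ σ a - 1 := by
  cases a <;> simp only [step, exitWeight, offset, Option.some.injEq, reduceCtorEq] at h ⊢
  all_goals
    split_ifs at h with h'
    exact ⟨_, rfl, by lia⟩

/-! ### The weights of the error search -/

section

variable {S A : Type} (D : DFA CounterOp S) (op : A → CounterOp) (σ₀ : ℕ → ℕ)

open Classical in
/-- The transitions of the automaton: `inl q` simulates `D`, `inr (some c)` watches out for an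
illegal occurrence of `c`, and `inr none` reads the rest of the word. -/
noncomputable def delta : S ⊕ Option A → A → S ⊕ Option A → Option ℤ
  | .inl q, a, .inl q' => if q' = D.step q (op a) then some 0 else none
  | .inr (some c), a, .inr (some c') => if c' = c then some (drift (op c) (op a)) else none
  | .inr (some c), a, .inr none => if a = c then exitWeight σ₀ (op c) else none
  | .inr none, _, .inr none => some 0
  | _, _, _ => none

-- A watcher that has not made its claim cannot accept. A finished one adds nothing, and a rejected
-- word costs -1 in the simulation of `D`.
open Classical in
noncomputable def final : S ⊕ Option A → Option ℤ
  | .inl q => some (if q ∈ D.accept then 0 else -1)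
  | .inr (some _) => none
  | .inr none => some 0

open Classical in
variable (A) in
noncomputable def initial [Fintype S] [Fintype A] : Finset (S ⊕ Option A) :=
  Finset.univ.filter fun t => t = .inl D.start ∨ ∃ c, t = .inr (some c)

variable {D op σ₀}

theorem mem_initial [Fintype S] [Fintype A] {t : S ⊕ Option A} :
    t ∈ initial A D ↔ t = .inl D.start ∨ ∃ c, t = .inr (some c) := by
  simp [initial]

theorem wordWeight_rest {u : List A} {x : ℤ} :
    WordWeight (delta D op σ₀) (final D) (.inr none) u x ↔ x = 0 := by
  induction u generalizing x with
  | nil => simp [WordWeight, final, eq_comm]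
  | cons a u ih =>
    constructor
    · rintro ⟨s, y, z, h1, h2, rfl⟩
      rcases s with q | _ | c
      · simp [delta] at h1
      · simp only [delta, Option.some.injEq] at h1
        rw [← h1, ih.1 h2, add_zero]
      · simp [delta] at h1
    · rintro rfl
      exact ⟨.inr none, 0, 0, rfl, ih.2 rfl, rfl⟩

open Classical in
theorem wordWeight_dfa {u : List A} {x : ℤ} {q : S} :
    WordWeight (delta D op σ₀) (final D) (.inl q) u x ↔
      x = if D.evalFrom q (u.map op) ∈ D.accept then 0 else -1 := by
  induction u generalizing x q with
  | nil => simp [WordWeight, final, eq_comm]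
  | cons a u ih => simp [WordWeight, delta, ih]

theorem wordWeight_watch_cons {a c : A} {u : List A} {x : ℤ} :
    WordWeight (delta D op σ₀) (final D) (.inr (some c)) (a :: u) x ↔
      (∃ z, WordWeight (delta D op σ₀) (final D) (.inr (some c)) u z ∧
        x = drift (op c) (op a) + z) ∨ (a = c ∧ exitWeight σ₀ (op c) = some x) := by
  constructor
  · rintro ⟨s, y, z, h1, h2, rfl⟩
    rcases s with q | _ | c'
    · simp [delta] at h1
    · rw [wordWeight_rest] at h2
      subst h2
      simp only [delta] at h1
      split_ifs at h1 with h
      exact Or.inr ⟨h, by simpa using h1⟩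
    · simp only [delta] at h1
      split_ifs at h1 with h
      rw [← Option.some.inj h1]
      exact Or.inl ⟨z, h ▸ h2, rfl⟩
  · rintro (⟨z, hz, rfl⟩ | ⟨rfl, h⟩)
    · exact ⟨.inr (some c), _, z, by simp [delta], hz, rfl⟩
    · exact ⟨.inr none, x, 0, by simp [delta, h], wordWeight_rest.2 rfl, by simp⟩

theorem offset_le_of_wordWeight {c : A} {u : List A} {x : ℤ} {σ τ : ℕ → ℕ}
    (hσ : run (u.map op) σ = some τ)
    (h : WordWeight (delta D op σ₀) (final D) (.inr (some c)) u x) : offset σ₀ σ (op c) ≤ x := by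
  induction u generalizing x σ with
  | nil => simp [WordWeight, final] at h
  | cons a u ih =>
    rw [List.map_cons, run, Option.bind_eq_some_iff] at hσ
    obtain ⟨ρ, h1, h2⟩ := hσ
    rcases wordWeight_watch_cons.1 h with ⟨z, hz, rfl⟩ | ⟨rfl, h⟩
    · rw [offset_eq_drift_add h1]
      have := ih h2 hz
      lia
    · exact offset_le_exitWeight h1 h

/-- Watch for the first illegal instruction: all steps before it are legal, so the potential
argument is valid up to there. -/
theorem exists_wordWeight_le_offset {u : List A} {σ : ℕ → ℕ} (hσ : run (u.map op) σ = none) :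
    ∃ c x, WordWeight (delta D op σ₀) (final D) (.inr (some c)) u x ∧
      x ≤ offset σ₀ σ (op c) - 1 := by
  induction u generalizing σ with
  | nil => simp [run] at hσ
  | cons a u ih =>
    rw [List.map_cons, run] at hσ
    cases h1 : step (op a) σ with
    | none =>
      obtain ⟨y, hy, hy'⟩ := exists_exitWeight_le (σ₀ := σ₀) h1
      exact ⟨a, y, wordWeight_watch_cons.2 (Or.inr ⟨rfl, hy⟩), hy'⟩
    | some ρ =>
      rw [h1] at hσ
      obtain ⟨c, z, hz, hz'⟩ := ih hσ
      refine ⟨c, _, wordWeight_watch_cons.2 (Or.inl ⟨z, hz, rfl⟩), ?_⟩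
      rw [offset_eq_drift_add h1]
      lia

variable [Fintype S] [Fintype A]

theorem exists_wordWeight_nonpos (u : List A) :
    ∃ s ∈ initial A D, ∃ x ≤ 0, WordWeight (delta D op σ₀) (final D) s u x := by
  refine ⟨_, mem_initial.2 (Or.inl rfl), _, ?_, wordWeight_dfa.2 rfl⟩
  split_ifs <;> simp

theorem wordWeight_nonneg {u : List A} (hu : u.map op ∈ D.accepts) {τ : ℕ → ℕ}
    (hτ : run (u.map op) σ₀ = some τ) {s : S ⊕ Option A} (hs : s ∈ initial A D) {x : ℤ}
    (h : WordWeight (delta D op σ₀) (final D) s u x) : 0 ≤ x := by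
  rcases mem_initial.1 hs with rfl | ⟨c, rfl⟩
  · rw [wordWeight_dfa] at h
    exact (h.trans (if_pos hu)).ge
  · rw [← offset_self σ₀ (op c)]
    exact offset_le_of_wordWeight hτ h

theorem exists_wordWeight_neg (u : List A)
    (h : u.map op ∈ D.accepts → run (u.map op) σ₀ = none) :
    ∃ s ∈ initial A D, ∃ x ≤ -1, WordWeight (delta D op σ₀) (final D) s u x := by
  by_cases hu : u.map op ∈ D.accepts
  · obtain ⟨c, x, hx, hx'⟩ := exists_wordWeight_le_offset (D := D) (σ₀ := σ₀) (h hu)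
    rw [offset_self] at hx'
    exact ⟨_, mem_initial.2 (Or.inr ⟨c, rfl⟩), x, by lia, hx⟩
  · exact ⟨_, mem_initial.2 (Or.inl rfl), _, le_rfl, wordWeight_dfa.2 (if_neg hu).symm⟩

/-- Long illegal blocks may have very negative weight. The empty block has no watcher that accepts,
and its recurrence keeps the value of the word from falling below -1. -/
theorem neg_one_le_wordWeight_nil {s : S ⊕ Option A} (hs : s ∈ initial A D) {x : ℤ}
    (h : WordWeight (delta D op σ₀) (final D) s [] x) : -1 ≤ x := by
  rcases mem_initial.1 hs with rfl | ⟨c, rfl⟩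
  · rw [wordWeight_dfa] at h
    rw [h]
    split_ifs <;> simp
  · simp [WordWeight, final] at h

end

end Check

/-! ### The automaton of a counter program and an input -/

theorem uniformBinary_ae_frequently_block (M : ℕ) :
    ∀ᵐ w ∂MarkovChain.uniformBinary.wordMeasure, ∀ u : List (Fin (M + 1)),
      ∃ᶠ i in atTop, parse M w i = none ∧ subword w i (block u).length = block u := by
  filter_upwards [uniformBinary_ae_frequently_pattern] with w hw u
  rw [frequently_atTop]
  intro a
  obtain ⟨i, hi, h⟩ := frequently_atTop.1 (hw (0 :: (List.replicate (M + 1) 1 ++ block u))) a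
  exact ⟨i + (M + 2), by lia, parse_eq_none_of_subword ((subword_eq_iff _ _ _).2 h)⟩

section

variable {S : Type} [Fintype S] {M : ℕ} (D : DFA CounterOp S) (op : Fin (M + 1) → CounterOp)

noncomputable def checkNWA (n : ℕ) : NWA 2 :=
  blockNWA (Check.initial (Fin (M + 1)) D) (Check.delta D op (Function.update 0 0 n))
    (Check.final D)

theorem ae_accepts_checkNWA (n : ℕ) :
    ∀ᵐ w ∂MarkovChain.uniformBinary.wordMeasure, (checkNWA D op n).Accepts w := by
  filter_upwards [uniformBinary_ae_frequently_block M] with w hw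
  exact accepts_blockNWA ((hw []).mono fun i hi => hi.1) Check.exists_wordWeight_nonpos

theorem ae_value_checkNWA_of_halts {n : ℕ} {u : List (Fin (M + 1))} (hu : u.map op ∈ D.accepts)
    {τ : ℕ → ℕ} (hτ : run (u.map op) (Function.update 0 0 n) = some τ) :
    ∀ᵐ w ∂MarkovChain.uniformBinary.wordMeasure, (checkNWA D op n).limSupSumValue w = 0 := by
  filter_upwards [uniformBinary_ae_frequently_block M] with w hw
  refine le_antisymm ?_ ?_
  · simpa [checkNWA] using limSupSumValue_blockNWA_le (c := 0) ((hw []).mono fun i hi => hi.1)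
      Check.exists_wordWeight_nonpos
  · simpa [checkNWA] using le_limSupSumValue_blockNWA (c := 0) (hw u)
      fun s hs x hx => Check.wordWeight_nonneg hu hτ hs hx

theorem ae_value_checkNWA_of_not_halts {n : ℕ} (h : ∀ u : List (Fin (M + 1)),
    u.map op ∈ D.accepts → run (u.map op) (Function.update 0 0 n) = none) :
    ∀ᵐ w ∂MarkovChain.uniformBinary.wordMeasure, (checkNWA D op n).limSupSumValue w = -1 := by
  filter_upwards [uniformBinary_ae_frequently_block M] with w hw
  refine le_antisymm ?_ ?_
  · simpa [checkNWA] using limSupSumValue_blockNWA_le (c := -1) ((hw []).mono fun i hi => hi.1)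
      fun u => Check.exists_wordWeight_neg u (h u)
  · simpa [checkNWA] using le_limSupSumValue_blockNWA (c := -1) (hw [])
      fun s hs x hx => Check.neg_one_le_wordWeight_nil hs hx

end

/-! ### Computability of the construction -/

/-- The encoding interleaves: `n` goes to `2 * n` and `-(n + 1)` to `2 * n + 1`. Arithmetic on `ℤ`
thereby becomes arithmetic on codes in `ℕ`. -/
theorem encode_int (z : ℤ) :
    Encodable.encode z = if 0 ≤ z then 2 * z.natAbs else 2 * z.natAbs - 1 := by
  cases z with
  | ofNat n => exact (if_pos (Int.natCast_nonneg n)).symm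
  | negSucc n =>
    rw [if_neg (by lia)]
    change 2 * n + 1 = 2 * (n + 1) - 1
    lia

theorem primrec_intCast : Primrec fun n : ℕ => (n : ℤ) :=
  Primrec.encode_iff.1 ((Primrec.nat_mul.comp (Primrec.const 2) Primrec.id).of_eq fun n => by
    simp [encode_int])

theorem primrec_neg_intCast : Primrec fun n : ℕ => -(n : ℤ) :=
  Primrec.encode_iff.1 ((Primrec.nat_sub.comp
    (Primrec.nat_mul.comp (Primrec.const 2) Primrec.id) (Primrec.const 1)).of_eq fun n => by
      rw [encode_int]
      split_ifs with h
      · obtain rfl : n = 0 := by lia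
        rfl
      · simp)

theorem primrec_intCast_sub_one : Primrec fun n : ℕ => (n : ℤ) - 1 :=
  (Primrec.nat_casesOn Primrec.id (Primrec.const (-1)) (primrec_intCast.comp₂ Primrec₂.right)).of_eq
    fun n => by cases n <;> simp

theorem primrec_natAbs : Primrec Int.natAbs :=
  (Primrec.nat_div.comp (Primrec.succ.comp Primrec.encode) (Primrec.const 2)).of_eq fun z => by
    rw [encode_int]
    split_ifs <;> lia

theorem primrec_table {α Y : Type} [Primcodable α] [Primcodable Y] {l m n : ℕ}
    {f : α → Fin l → Fin m → Fin n → Y} (hf : ∀ a b c, Primrec fun x => f x a b c) :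
    Primrec fun x => table (f x) := by
  simp only [table, ← List.ofFn_eq_map]
  exact Primrec.list_ofFn fun a => Primrec.list_ofFn fun b => Primrec.list_ofFn fun c => hf a b c

/-- The states and their numbering do not depend on the parameter. The code is a table of fixed size
whose entries are primitive recursive, so the noncomputable choice of numbering is harmless. -/
theorem primrec_encode_ofFintype {α Q : Type} [Primcodable α] [Fintype Q] {k : ℕ}
    (init accept : Finset Q) {δ : α → Q → Fin k → Q → Option ℤ}
    (hδ : ∀ q b q', Primrec fun x => δ x q b q') :
    Primrec fun x => (ofFintype init accept (δ x)).encode id := by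
  refine (Primrec.const (Fintype.card Q)).pair
    ((Primrec.const ((List.finRange (Fintype.card Q)).map fun q =>
      decide (q ∈ init.map (Fintype.equivFin Q).toEmbedding))).pair
    ((Primrec.const ((List.finRange (Fintype.card Q)).map fun q =>
      decide (q ∈ accept.map (Fintype.equivFin Q).toEmbedding))).pair
    (primrec_table (l := Fintype.card Q) (n := Fintype.card Q)
      (f := fun x q b q' => Option.map id (δ x ((Fintype.equivFin Q).symm q) b
        ((Fintype.equivFin Q).symm q'))) fun q b q' => ?_)))
  simpa using hδ _ _ _

section

variable {S : Type} {M : ℕ} (D : DFA CounterOp S) (op : Fin (M + 1) → CounterOp)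

theorem primrec_exitWeight (c : CounterOp) :
    Primrec fun n => Check.exitWeight (Function.update 0 0 n) c := by
  cases c with
  | inc r => exact Primrec.const none
  | dec r =>
    refine Primrec.option_some.comp ?_
    by_cases h : r = 0
    · simpa [h] using primrec_intCast_sub_one
    · simpa [h] using Primrec.const (-1)
  | zero r =>
    refine Primrec.option_some.comp ?_
    by_cases h : r = 0
    · simpa [h] using primrec_neg_intCast
    · simpa [h] using Primrec.const 0

theorem primrec_delta (t : S ⊕ Option (Fin (M + 1))) (a : Fin (M + 1))
    (t' : S ⊕ Option (Fin (M + 1))) :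
    Primrec fun n => Check.delta D op (Function.update 0 0 n) t a t' := by
  rcases t with q | _ | c <;> rcases t' with q' | _ | c' <;> simp only [Check.delta]
  all_goals first | exact Primrec.const _ | skip
  split_ifs
  · exact primrec_exitWeight _
  · exact Primrec.const _

theorem primrec_blockDelta (q : Option ((S ⊕ Option (Fin (M + 1))) × Fin (M + 1))) (b : Fin 2)
    (q' : Option ((S ⊕ Option (Fin (M + 1))) × Fin (M + 1))) :
    Primrec fun n => blockDelta (Check.delta D op (Function.update 0 0 n)) (Check.final D)
      q b q' := by
  rcases q with _ | ⟨s, j⟩ <;> rcases q' with _ | ⟨s', j'⟩ <;> simp only [blockDelta]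
  all_goals first | exact Primrec.const _ | skip
  split_ifs
  · exact primrec_delta D op _ _ _
  all_goals exact Primrec.const _

theorem primrec_encode_checkNWA [Fintype S] : Primrec fun n => (checkNWA D op n).encode := by
  refine (Primrec.const 2).pair ((Primrec.const ((blockMaster M).encode Fin.val)).pair ?_)
  simp only [← List.ofFn_eq_map]
  exact Primrec.list_ofFn (n := 2)
    (f := fun i n => ((checkNWA D op n).slave i).encode id) (Fin.forall_fin_two.2
    ⟨Primrec.const (silentSlave.encode id),
      primrec_encode_ofFintype _ _ (primrec_blockDelta D op)⟩)

end

/-! ### Reductions -/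

/-- A solver may diverge or err on invalid inputs, but every `x n` is valid, so composing it with
`d` gives a total decision procedure for `P`. -/
theorem not_solvable_of_reduction {ι α β : Type} [Primcodable α] [Primcodable β] {enc : ι → α}
    {valid : ι → Prop} {correct : ι → β → Prop} {P : ℕ → Prop} (hP : ¬ ComputablePred P)
    (x : ℕ → ι) (hx : Computable fun n => enc (x n)) (hvalid : ∀ n, valid (x n)) {d : β → Bool}
    (hd : Computable d) (hcorrect : ∀ n y, correct (x n) y → (d y = true ↔ P n)) :
    ¬ Solvable enc valid correct := by
  rintro ⟨f, hf, h⟩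
  classical
  refine hP ⟨inferInstance, ((hf.comp hx).map (hd.comp Computable.snd).to₂).of_eq fun n => ?_⟩
  obtain ⟨y, hy, hxy⟩ := h (x n) (hvalid n)
  rw [Part.eq_some_iff.2 hy, Part.map_some]
  congr 1
  rw [Bool.eq_iff_iff, hcorrect n y hxy]
  simp

/-- The test whether a rational number has absolute value at least `1 / 2`. -/
def isLarge (c : RatCode) : Bool := decide (c.2 ≠ 0 ∧ c.2 ≤ 2 * c.1.natAbs)

theorem computable_isLarge : Computable isLarge :=
  (PrimrecPred.decide ((Primrec.eq.comp Primrec.snd (Primrec.const 0)).not.and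
    (Primrec.nat_le.comp Primrec.snd (Primrec.nat_mul.comp (Primrec.const 2)
      (primrec_natAbs.comp Primrec.fst))))).to_comp

theorem isLarge_iff (c : RatCode) : isLarge c = true ↔ 1 / 2 ≤ |((decodeRat c : ℚ) : ℝ)| := by
  obtain ⟨z, n⟩ := c
  simp only [isLarge, decide_eq_true_eq, decodeRat]
  rcases Nat.eq_zero_or_pos n with rfl | hn
  -- With denominator 0 the code decodes to 0, which is not large.
  · simp
  · have hn' : (0 : ℝ) < n := by exact_mod_cast hn
    push_cast
    rw [abs_div, abs_of_pos hn', div_le_div_iff₀ two_pos hn', one_mul, ← Int.cast_abs,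
      Int.abs_eq_natAbs]
    constructor
    · rintro ⟨-, h⟩
      rw [mul_comm]
      exact_mod_cast h
    · intro h
      rw [mul_comm] at h
      exact ⟨hn.ne', by exact_mod_cast h⟩

/-- An output within 1/4 of `v` has absolute value at least 3/4, and one within 1/4 of 0 at most
1/4; the threshold 1/2 separates the two. -/
theorem isLarge_iff_of_abs_sub_le {c : RatCode} {p : Prop} [Decidable p] {v : ℝ} (hv : |v| = 1)
    (h : |((decodeRat c : ℚ) : ℝ) - if p then v else 0| ≤ 1 / 4) : isLarge c = true ↔ p := by
  rw [isLarge_iff]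
  split_ifs at h with hp
  · have := abs_sub_abs_le_abs_sub v (decodeRat c : ℚ)
    rw [abs_sub_comm] at this
    exact iff_of_true (by linarith) hp
  · rw [sub_zero] at h
    exact iff_of_false (by linarith) hp

/-! ### Almost surely constant values and the undecidable family -/

theorem Instance.hasExpectedValue_iff_of_ae_eq {x : Instance}
    [IsProbabilityMeasure x.chain.wordMeasure] {v : ℝ}
    (h : ∀ᵐ w ∂x.chain.wordMeasure, x.value w = (v : EReal)) {e : ℝ} :
    x.HasExpectedValue e ↔ e = v := by
  have h' : (fun w => (x.value w).toReal) =ᵐ[x.chain.wordMeasure] fun _ => v := by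
    filter_upwards [h] with w hw
    rw [hw, EReal.toReal_coe]
  rw [Instance.HasExpectedValue, integral_congr_ae h']
  constructor
  · rintro ⟨-, -, rfl⟩
    simp
  · rintro rfl
    refine ⟨?_, (integrable_const e).congr h'.symm, by simp⟩
    filter_upwards [h] with w hw
    rw [hw]
    exact ⟨EReal.coe_ne_top _, EReal.coe_ne_bot _⟩

theorem Instance.distribution_of_ae_eq {x : Instance}
    [IsProbabilityMeasure x.chain.wordMeasure] {v : ℝ}
    (h : ∀ᵐ w ∂x.chain.wordMeasure, x.value w = (v : EReal)) (t : ℝ) :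
    x.distribution t = if v ≤ t then 1 else 0 := by
  rw [Instance.distribution, measureReal_def]
  split_ifs with hvt
  · have h' : {w | x.value w ≤ (t : EReal)} =ᵐ[x.chain.wordMeasure] Set.univ := by
      refine eventuallyEq_univ.2 ?_
      filter_upwards [h] with w hw
      simpa [hw] using hvt
    rw [measure_congr h', measure_univ, ENNReal.toReal_one]
  · rw [measure_eq_zero_iff_ae_notMem.2, ENNReal.toReal_zero]
    filter_upwards [h] with w hw
    simpa [hw] using hvt

theorem exists_undecidable_family : ∃ (A : ℕ → NWA 2) (P : ℕ → Prop), ¬ ComputablePred P ∧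
    (Computable fun n => (A n).encode) ∧ (∀ n, (A n).HasWidth 1) ∧
    (∀ n, ∀ᵐ w ∂MarkovChain.uniformBinary.wordMeasure, (A n).Accepts w) ∧
    (∀ n, P n → ∀ᵐ w ∂MarkovChain.uniformBinary.wordMeasure, (A n).limSupSumValue w = -1) ∧
    ∀ n, ¬ P n → ∀ᵐ w ∂MarkovChain.uniformBinary.wordMeasure, (A n).limSupSumValue w = 0 := by
  obtain ⟨p, hp⟩ := CounterProgram.exists_not_computablePred_haltsOn
  obtain ⟨S, _, D, hD⟩ := p.regular
  obtain ⟨M, op, hop⟩ : ∃ (M : ℕ) (op : Fin (M + 1) → CounterOp),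
      ∀ a ∈ p.ops, a ∈ Set.range op := by
    -- The inserted instruction only ensures that the alphabet is nonempty, hence of size `M + 1`.
    have e := (insert (CounterOp.inc 0) p.ops).equivFin
    refine ⟨(insert (CounterOp.inc 0) p.ops).card - 1, fun i => (e.symm (i.cast ?_) : CounterOp),
      fun a ha => ?_⟩
    · exact Nat.sub_add_cancel (Finset.card_pos.2 (Finset.insert_nonempty _ _))
    · exact ⟨(e ⟨a, Finset.mem_insert_of_mem ha⟩).cast
        (Nat.sub_add_cancel (Finset.card_pos.2 (Finset.insert_nonempty _ _))).symm, by simp⟩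
  refine ⟨checkNWA D op, fun n => ¬ p.HaltsOn n, fun h => hp (h.not.of_eq fun n => not_not),
    (primrec_encode_checkNWA D op).to_comp, fun n => hasWidth_blockNWA _ _ _,
    ae_accepts_checkNWA D op, fun n hn => ?_, fun n hn => ?_⟩
  · refine ae_value_checkNWA_of_not_halts D op fun u hu => ?_
    rw [Option.eq_none_iff_forall_not_mem]
    intro τ hτ
    exact hn ⟨τ, u.map op, hD ▸ hu, hτ⟩
  · obtain ⟨τ, u, hu, hτ⟩ := not_not.1 hn
    -- The halting computation uses only instructions from `p.ops`, so it can be written in coded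
    -- letters.
    obtain ⟨u, rfl⟩ : ∃ u', List.map op u' = u := by
      have : u ∈ Set.range (List.map op) := by
        rw [Set.range_list_map]
        exact fun a ha => hop a (p.mem_ops u hu a ha)
      exact this
    exact ae_value_checkNWA_of_halts D op (hD ▸ hu) hτ

end NWAProb

theorem mainTheorem11 :
    ¬ ZeroOrMinusOneQuestion ∧
    ∀ C : Set Instance, C = Instance.widthOne ∨ C = Instance.widthOneUniform →
      ¬ ExpectedQuestion C ∧
      ¬ DistributionQuestion C ∧
      ¬ ApproxExpectedQuestion C ∧
      ¬ ApproxDistributionQuestion C ∧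
      ¬ AlmostSureQuestion C := by
  obtain ⟨A, P, hP, hA, hwidth, hacc, hneg, hzero⟩ := exists_undecidable_family
  have hnot : ¬ ComputablePred fun n => ¬ P n := fun h => hP (h.not.of_eq fun n => not_not)
  refine ⟨?_, fun C hC => ?_⟩
  · refine not_solvable_of_reduction hnot A hA (fun n => ⟨hwidth n, ?_⟩) Computable.id
      fun n y hy => ?_
    · by_cases h : P n
      · exact Or.inr (hneg n h)
      · exact Or.inl (hzero n h)
    · rw [id, hy]
      -- The two almost sure values exclude each other, since in a probability space two almost sure
      -- events have a common point.
      refine ⟨fun h0 h => ?_, hzero n⟩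
      obtain ⟨w, hw0, hw1⟩ := (h0.and (hneg n h)).exists
      rw [hw0] at hw1
      have h1 : ((0 : ℝ) : EReal) = ((-1 : ℝ) : EReal) := by simpa using hw1
      have h2 := EReal.coe_injective h1
      norm_num at h2
  let x : ℕ → Instance := fun n => ⟨2, A n, MarkovChain.uniformBinary⟩
  have hprob : ∀ n, IsProbabilityMeasure (x n).chain.wordMeasure := fun n =>
    inferInstanceAs (IsProbabilityMeasure MarkovChain.uniformBinary.wordMeasure)
  have hx : Computable fun n => (x n).encode :=
    hA.pair (Computable.const MarkovChain.uniformBinary.encode)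
  have hxC : ∀ n, x n ∈ C := by
    intro n
    have h : x n ∈ Instance.widthOne := ⟨hwidth n, hacc n⟩
    rcases hC with rfl | rfl
    · exact h
    · exact ⟨h, A n, rfl⟩
  classical
  have hval : ∀ n, ∀ᵐ w ∂(x n).chain.wordMeasure,
      (x n).value w = ((if P n then -1 else 0 : ℝ) : EReal) := by
    intro n
    by_cases h : P n
    · filter_upwards [hneg n h] with w hw
      exact hw.trans (by simp [h])
    · filter_upwards [hzero n h] with w hw
      exact hw.trans (by simp [h])
  have hexp : ∀ n e, (x n).HasExpectedValue e ↔ e = if P n then -1 else 0 := fun n e =>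
    Instance.hasExpectedValue_iff_of_ae_eq (hval n)
  -- The threshold -1 admits the value -1 but not 0.
  have hdist : ∀ n, (x n).distribution ((-1 : ℚ) : ℝ) = if P n then 1 else 0 := by
    intro n
    rw [Instance.distribution_of_ae_eq (hval n)]
    by_cases h : P n <;> simp [h]
  refine ⟨?_, ?_, ?_, ?_, ?_⟩
  · refine not_solvable_of_reduction hP x hx
      (fun n => ⟨hxC n, if P n then -1 else 0, ?_⟩) computable_isLarge fun n c hc => ?_
    · rw [hexp]
      split_ifs <;> simp
    · exact isLarge_iff_of_abs_sub_le (v := -1) (by simp) (by rw [(hexp n _).1 hc]; norm_num)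
  · refine not_solvable_of_reduction hP (fun n => (x n, (-1 : ℚ)))
      (hx.pair (Computable.const (encodeRat (-1))))
      (fun n => ⟨hxC n, if P n then 1 else 0, ?_⟩) computable_isLarge fun n c hc => ?_
    · rw [hdist]
      split_ifs <;> simp
    · exact isLarge_iff_of_abs_sub_le (v := 1) (by simp) (by rw [← hc, hdist]; norm_num)
  · refine not_solvable_of_reduction hP (fun n => (x n, (1 / 4 : ℚ)))
      (hx.pair (Computable.const (encodeRat (1 / 4))))
      (fun n => ⟨hxC n, by norm_num, _, (hexp n _).2 rfl⟩) computable_isLarge fun n c hc => ?_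
    obtain ⟨e, he, hce⟩ := hc
    rw [(hexp n e).1 he] at hce
    exact isLarge_iff_of_abs_sub_le (v := -1) (by simp) (by simpa using hce)
  · refine not_solvable_of_reduction hP (fun n => (x n, (-1 : ℚ), (1 / 4 : ℚ)))
      (hx.pair (Computable.const (encodeRat (-1), encodeRat (1 / 4))))
      (fun n => ⟨hxC n, by norm_num⟩)
      computable_isLarge fun n c hc => ?_
    simp only [hdist] at hc
    exact isLarge_iff_of_abs_sub_le (v := 1) (by simp) (by simpa using hc)
  · refine not_solvable_of_reduction hP (fun n => (x n, (-1 : ℚ)))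
      (hx.pair (Computable.const (encodeRat (-1))))
      hxC Computable.id fun n b hb => ?_
    rw [id, hb, hdist]
    by_cases h : P n <;> simp [h]
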